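/- There is an absolute constant $C>0$ such that the following holds. Let $q>1$ be an integer, let $\chi$ be a primitive Dirichlet character modulo $q$, and assume the generalized Riemann hypothesis for $L(s,\chi)$: every zero of $L(s,\chi)$ with $0<\Re s<1$ satisfies $\Re s=\tfrac12$. Let $t\ge 2$ and $4\le x\le t^2$ be real numbers and put $\sigma_1=\frac12+\frac1{\log x}$. For integers $1\le n\le x^2$ put $$\Lambda_x(n)=\begin{cases}\Lambda(n), & 1\le n\le x,\\ \Lambda(n)\,\dfrac{\log (x^2/n)}{\log x}, & x\le n\le x^2,\end{cases}$$ where $\Lambda$ is the von Mangoldt function. Then there is a real number $\omega'$ with $-1\le\omega'\le 1$, depending on $\chi,t,x$ but not on $\sigma$, such that for every real $\sigma\ge\sigma_1$ there are complex numbers $\omega$ and $R$ with $|\omega|\le 1$, $|R|\le C\,x^{\frac12-\sigma}$ and $$\frac{L'}{L}(\sigma+it,\chi)=-\sum_{n<x^2}\frac{\Lambda_x(n)\chi(n)}{n^{\sigma+it}}-\frac{x^{\frac12-\sigma}\bigl(1+x^{\frac12-\sigma}\bigr)\omega}{1-\frac1e\bigl(1+\frac1e\bigr)\omega'}\,\Re\Bigl(\sum_{n<x^2}\frac{\Lambda_x(n)\chi(n)}{n^{\sigma_1+it}}\Bigr)+\frac{x^{\frac12-\sigma}\bigl(1+x^{\frac12-\sigma}\bigr)\omega}{1-\frac1e\bigl(1+\frac1e\bigr)\omega'}\cdot\frac12\log\bigl(q(t+1)\bigr)+R,$$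 with the same $\omega$ and $\omega'$ in both correction terms. -/

import Mathlib

/-- The generalized Riemann hypothesis for `L(s, χ)`: every non-trivial zero, that is, every zero
in the open critical strip `0 < Re s < 1`, has real part `1/2`. -/
def GRHFor {q : ℕ} [NeZero q] (χ : DirichletCharacter ℂ q) : Prop :=
  ∀ s : ℂ, DirichletCharacter.LFunction χ s = 0 → 0 < s.re → s.re < 1 → s.re = 1 / 2

/-- The smoothed von Mangoldt function `Λ_x(n)`, extended by `0` to `n > x ^ 2`. -/
noncomputable def smoothedVonMangoldt (x : ℝ) (n : ℕ) : ℝ :=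
  if (n : ℝ) ≤ x then ArithmeticFunction.vonMangoldt n
  else if (n : ℝ) ≤ x ^ 2 then
    ArithmeticFunction.vonMangoldt n * (Real.log (x ^ 2 / n) / Real.log x)
  else 0

/-- The sum of `Λ_x(n) χ(n) / n ^ s` over the integers `1 ≤ n < x ^ 2`
(for natural `n`, `n < ⌈x ^ 2⌉₊` is the same as `n < x ^ 2`). -/
noncomputable def smoothedPrimeSum {q : ℕ} (χ : DirichletCharacter ℂ q) (x : ℝ) (s : ℂ) : ℂ :=
  ∑ n ∈ Finset.Ico 1 ⌈x ^ 2⌉₊, (smoothedVonMangoldt x n : ℂ) / (n : ℂ) ^ s * χ (n : ZMod q)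

/-- `σ₁ = 1/2 + 1/log x`. -/
noncomputable def sigmaOne (x : ℝ) : ℝ := 1 / 2 + 1 / Real.log x

/-- The factor `x^{1/2-σ} (1 + x^{1/2-σ}) ω / (1 - e⁻¹ (1 + e⁻¹) ω')`. -/
noncomputable def correctionFactor (x σ : ℝ) (ω : ℂ) (ω' : ℝ) : ℂ :=
  ((x ^ (1 / 2 - σ) * (1 + x ^ (1 / 2 - σ)) : ℝ) : ℂ) * ω /
    ((1 - 1 / Real.exp 1 * (1 + 1 / Real.exp 1) * ω' : ℝ) : ℂ)

/-! ### Partial fractions for entire functions with zeros on a line -/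

section

open Complex Metric Filter Topology

/-! This is Selberg's method. Write `Λ(s)` for the completed L-function and `ρ = 1/2 + iγ` for its
zeros. The explicit formula expresses `L'/L(s)` as minus the smoothed prime sum, plus `(1 / log x) ∑
(x^(ρ-s) - x^(2(ρ-s))) / (s-ρ)²` over all zeros, plus the same sum over the trivial zeros, which is
`O(x^(1/2-σ))`.

Let `A = ∑ Re 1/(σ₁+it-ρ)`. Under GRH each numerator is at most `x^(1/2-σ) (1 + x^(1/2-σ))`. For `σ
≥ σ₁`, `|s-ρ|` is at least `|σ₁+it-ρ|`, and `(σ₁ - 1/2) log x = 1` turns `1 / (log x |σ₁+it-ρ|²)`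
into `Re 1/(σ₁+it-ρ)`. So the zeros contribute `x^(1/2-σ) (1 + x^(1/2-σ)) ω A` with `|ω| ≤ 1`
(`norm_tsum_zeros_le`). On the other hand `A = Re L'/L(σ₁+it) + (1/2) log(q(t+1)) + O(1)`, by the
partial fractions of `Λ'/Λ` and the size of the digamma function. Real parts of the explicit formula
at `σ₁`, where `x^(1/2-σ₁) = 1/e`, give a linear equation for `A` whose coefficient is the stated
denominator; its solution is substituted at `σ` (`eq_of_explicit_formula`).

Two analytic inputs carry the argument. The partial fractions of `Λ'/Λ` use neither Hadamard
products nor zero counting: zeros in a disc of radius `R` are divided out, and growth `exp(o(R²))`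
makes the second logarithmic derivative of the quotient tend to zero (`exists_factorization_ball`,
`hasSum_logDeriv_sub_logDeriv`). The explicit formula uses no contour shift: both sides, as
functions of `u = log x`, have the same Laplace transform on `re z = 2`, so they agree by Fourier
inversion (`tsum_mul_max_sub_log_eq`, `explicit_formula`). -/

theorem Differentiable.analyticOrderAt_ne_top {f : ℂ → ℂ} (hf : Differentiable ℂ f) {c : ℂ}
    (hc : f c ≠ 0) (w : ℂ) : analyticOrderAt f w ≠ ⊤ := by
  rw [Ne, analyticOrderAt_eq_top]
  intro h
  have hf' : AnalyticOnNhd ℂ f Set.univ := fun z _ ↦ hf.analyticAt z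
  exact hc (hf'.eqOn_zero_of_preconnected_of_eventuallyEq_zero isPreconnected_univ
    (Set.mem_univ w) h (Set.mem_univ c))

theorem Differentiable.exists_eq_one_sub_div_pow_mul {f : ℂ → ℂ} (hf : Differentiable ℂ f) {w : ℂ}
    (hw : w ≠ 0) (hfw : analyticOrderAt f w ≠ ⊤) :
    ∃ h : ℂ → ℂ, Differentiable ℂ h ∧ h w ≠ 0 ∧
      ∀ z, f z = (1 - z / w) ^ analyticOrderNatAt f w * h z := by
  obtain ⟨g, hg, hgw, hfg⟩ := ((hf.analyticAt w).analyticOrderAt_ne_top).1 hfw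
  set n := analyticOrderNatAt f w
  have key : ∀ z, (z - w) ^ n = (1 - z / w) ^ n * (-w) ^ n := fun z ↦ by
    rw [← mul_pow]; congr 1; field_simp; ring
  have hne : ∀ z, z ≠ w → (1 - z / w) ≠ 0 := fun z hz h ↦ hz (by
    field_simp at h; linear_combination -h)
  -- The value at `w` fills the removable singularity, because `(z - w)^n = (1 - z/w)^n (-w)^n`.
  set h : ℂ → ℂ := fun z ↦ if z = w then (-w) ^ n * g w else f z / (1 - z / w) ^ n with hh
  have hev : h =ᶠ[𝓝 w] fun z ↦ (-w) ^ n * g z := by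
    filter_upwards [hfg] with z hz
    simp only [hh]
    split_ifs with hzw
    · rw [hzw]
    · rw [hz, smul_eq_mul, key, div_eq_iff (pow_ne_zero _ (hne z hzw))]; ring
  refine ⟨h, fun z ↦ ?_, ?_, fun z ↦ ?_⟩
  · rcases eq_or_ne z w with rfl | hz
    · exact (hg.differentiableAt.const_mul _).congr_of_eventuallyEq hev
    · have : h =ᶠ[𝓝 z] fun y ↦ f y / (1 - y / w) ^ n := by
        filter_upwards [isOpen_ne.mem_nhds hz] with y hy
        simp only [hh, if_neg (show y ≠ w from hy)]
      refine DifferentiableAt.congr_of_eventuallyEq ?_ this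
      exact (hf z).div (by fun_prop) (pow_ne_zero _ (hne z hz))
  · simp only [hh, if_true]
    exact mul_ne_zero (pow_ne_zero _ (neg_ne_zero.2 hw)) hgw
  · rcases eq_or_ne z w with rfl | hz
    · rw [hfg.self_of_nhds]
      beta_reduce
      rw [smul_eq_mul, key, mul_assoc]
      simp [hh]
    · simp only [hh, if_neg hz]
      rw [mul_div_cancel₀ _ (pow_ne_zero _ (hne z hz))]

theorem Differentiable.exists_eq_prod_one_sub_div_pow_mul {f : ℂ → ℂ} (hf : Differentiable ℂ f)
    (hf0 : f 0 ≠ 0) (F : Finset ℂ) (hF : ∀ w ∈ F, w ≠ 0) :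
    ∃ h : ℂ → ℂ, Differentiable ℂ h ∧ (∀ w ∈ F, h w ≠ 0) ∧
      ∀ z, f z = (∏ w ∈ F, (1 - z / w) ^ analyticOrderNatAt f w) * h z := by
  classical
  induction F using Finset.induction_on with
  | empty => exact ⟨f, hf, by simp, by simp⟩
  | insert w F hw ih =>
    obtain ⟨h, hh, hne, hfh⟩ := ih fun v hv ↦ hF v (Finset.mem_insert_of_mem hv)
    have hw0 : w ≠ 0 := hF w (Finset.mem_insert_self _ _)
    set P : ℂ → ℂ := fun z ↦ ∏ v ∈ F, (1 - z / v) ^ analyticOrderNatAt f v with hP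
    have hPd : Differentiable ℂ P := by
      rw [hP]
      fun_prop
    have hPw : P w ≠ 0 := by
      refine Finset.prod_ne_zero_iff.2 fun v hv ↦ pow_ne_zero _ fun h0 ↦ hw ?_
      have hv0 : v ≠ 0 := hF v (Finset.mem_insert_of_mem hv)
      have : w = v := by field_simp at h0; linear_combination -h0
      exact this ▸ hv
    have hh0 : h 0 ≠ 0 := fun h0 ↦ hf0 (by rw [hfh, h0, mul_zero])
    have hfP : f = P * h := funext hfh
    -- The factors already divided out do not vanish at `w`, so they do not change the order there.
    have hord : analyticOrderNatAt f w = analyticOrderNatAt h w := by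
      have : analyticOrderAt P w = 0 := (hPd.analyticAt w).analyticOrderAt_eq_zero.2 hPw
      rw [analyticOrderNatAt, hfP, analyticOrderAt_mul (hPd.analyticAt w) (hh.analyticAt w), this,
        zero_add, analyticOrderNatAt]
    obtain ⟨k, hk, hkw, hhk⟩ := hh.exists_eq_one_sub_div_pow_mul hw0
      (hh.analyticOrderAt_ne_top hh0 w)
    refine ⟨k, hk, fun v hv ↦ ?_, fun z ↦ ?_⟩
    · rcases Finset.mem_insert.1 hv with rfl | hv
      · exact hkw
      · intro h0
        exact hne v hv (by rw [hhk, h0, mul_zero])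
    · rw [Finset.prod_insert hw, hfh z, hhk z, hord]
      ring

/-- A bound for `(log h)''` from a bound for `|h|`. -/
theorem norm_deriv_logDeriv_le {h : ℂ → ℂ} (hh : Differentiable ℂ h) {R M : ℝ} (hR : 0 < R)
    (hM : 0 < M) (hne : ∀ z ∈ ball (0 : ℂ) R, h z ≠ 0)
    (hle : ∀ z ∈ ball (0 : ℂ) R, ‖h z‖ ≤ ‖h 0‖ * Real.exp M) {z : ℂ}
    (hz : z ∈ ball (0 : ℂ) (R / 8)) :
    ‖deriv (logDeriv h) z‖ ≤ 64 * M / R ^ 2 := by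
  have h0 : h 0 ≠ 0 := hne 0 (mem_ball_self hR)
  have hld : DifferentiableOn ℂ (logDeriv h) (ball 0 R) := fun z hz ↦
    ((hh.deriv z).div (hh z) (hne z hz)).differentiableWithinAt
  -- The primitive `k` of `h'/h` with `k 0 = 0` is a logarithm of `h / h 0`; the growth bound says
  -- that its real part is at most `M`.
  obtain ⟨k, hk0, hk⟩ := hld.isExactOn_ball.with_val_at 0 0
  have hexp : ∀ z ∈ ball (0 : ℂ) R, h z = h 0 * cexp (k z) := by
    have hcon : ∀ z ∈ ball (0 : ℂ) R, HasDerivAt (fun z ↦ h z * cexp (-k z)) 0 z := fun z hz ↦ by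
      have := (hh z).hasDerivAt.mul (hk z hz).neg.cexp
      refine this.congr_deriv ?_
      rw [logDeriv_apply]
      field_simp [hne z hz]
      ring
    intro z hz
    have := (convex_ball (0 : ℂ) R).is_const_of_fderivWithin_eq_zero (𝕜 := ℂ)
      (f := fun z ↦ h z * cexp (-k z))
      (fun y hy ↦ (hcon y hy).differentiableAt.differentiableWithinAt)
      (fun y hy ↦ by
        rw [fderivWithin_of_isOpen isOpen_ball hy]
        have := (hcon y hy).hasFDerivAt.fderiv
        rw [this]; ext; simp) hz (mem_ball_self hR)
    simp only [hk0, neg_zero, Complex.exp_zero, mul_one] at this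
    rw [← this, mul_assoc, ← Complex.exp_add, neg_add_cancel, Complex.exp_zero, mul_one]
  have hkd : DifferentiableOn ℂ k (ball 0 R) := fun z hz ↦
    (hk z hz).differentiableAt.differentiableWithinAt
  have hre : Set.MapsTo k (ball 0 R) {z | z.re ≤ M} := fun z hz ↦ by
    have h1 := hle z hz
    rw [hexp z hz, norm_mul, Complex.norm_exp] at h1
    exact Real.exp_le_exp.1 (le_of_mul_le_mul_left h1 (norm_pos_iff.2 h0))
  -- Borel–Carathéodory gives `2M‖z‖ / (R - ‖z‖)`. Two Cauchy estimates follow, with radii `R/4` and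
  -- `R/8`, and `2M · (4/R) · (8/R) = 64M/R²`.
  have hk1 : ∀ z ∈ ball (0 : ℂ) R, ‖z‖ ≤ R / 2 → ‖k z‖ ≤ 2 * M := fun z hz hz2 ↦ by
    have := borelCaratheodory_zero hM hkd hre hR hz hk0
    refine this.trans ?_
    rw [div_le_iff₀ (by linarith)]
    nlinarith [norm_nonneg z]
  have cauchy : ∀ {u : ℂ → ℂ} {r C : ℝ} {y : ℂ}, 0 < r → DifferentiableOn ℂ u (ball 0 R) →
      ‖y‖ + r < R → (∀ v, ‖v‖ ≤ ‖y‖ + r → ‖u v‖ ≤ C) → ‖deriv u y‖ ≤ C / r := by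
    intro u r C y hr hu hyr hC
    have hsub : closedBall y r ⊆ ball 0 R := fun v hv ↦ by
      rw [mem_ball_zero_iff]
      have := norm_add_le y (v - y)
      rw [mem_closedBall, dist_eq_norm] at hv
      rw [add_sub_cancel] at this
      linarith
    refine norm_deriv_le_of_forall_mem_sphere_norm_le hr ?_ fun v hv ↦ hC v ?_
    · exact (hu.mono hsub).diffContOnCl_ball subset_rfl
    · have := norm_add_le y (v - y)
      rw [mem_sphere, dist_eq_norm] at hv
      rw [add_sub_cancel] at this
      linarith
  have hk2 : ∀ y, ‖y‖ ≤ R / 4 → ‖logDeriv h y‖ ≤ 8 * M / R := fun y hy ↦ by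
    have hyR : y ∈ ball (0 : ℂ) R := mem_ball_zero_iff.2 (by linarith)
    rw [← (hk y hyR).deriv]
    have := cauchy (u := k) (r := R / 4) (C := 2 * M) (y := y) (by positivity) hkd (by linarith)
      fun v hv ↦ hk1 v (mem_ball_zero_iff.2 (by linarith)) (by linarith)
    refine this.trans (le_of_eq ?_)
    field_simp
    norm_num
  rw [mem_ball_zero_iff] at hz
  have := cauchy (u := logDeriv h) (r := R / 8) (C := 8 * M / R) (y := z) (by positivity) hld
    (by linarith) fun v hv ↦ hk2 v (by linarith)
  refine this.trans (le_of_eq ?_)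
  field_simp
  norm_num

theorem Differentiable.finite_zeros_closedBall {f : ℂ → ℂ} (hf : Differentiable ℂ f)
    (hf0 : f 0 ≠ 0) (R : ℝ) : {w : ℂ | ‖w‖ ≤ R ∧ f w = 0}.Finite := by
  by_contra hinf
  obtain ⟨x, -, hx⟩ := Set.Infinite.exists_accPt_of_subset_isCompact hinf
    (isCompact_closedBall (0 : ℂ) R) fun w hw ↦ mem_closedBall_zero_iff.2 hw.1
  have hf' : AnalyticOnNhd ℂ f Set.univ := fun z _ ↦ hf.analyticAt z
  have hfr : ∃ᶠ z in 𝓝[≠] x, f z = 0 :=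
    (accPt_iff_frequently_nhdsNE.1 hx).mono fun z hz ↦ hz.2
  exact hf0 (hf'.eqOn_zero_of_preconnected_of_frequently_eq_zero isPreconnected_univ
    (Set.mem_univ x) hfr (Set.mem_univ 0))

section LineZeros

variable {g : ℂ → ℂ}

/-- On `|z| = 2R` every factor `1 - z/(iγ)` with `|γ| ≤ R` has modulus at least `2 - 1 = 1`, so
dividing by the product does not increase `|g|` there. The maximum principle carries the bound
inside, and `norm_deriv_logDeriv_le` then applies to the zero-free quotient with `M = o(R²)`. -/
theorem exists_factorization_ball (hg : Differentiable ℂ g) (hg0 : g 0 ≠ 0)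
    (hline : ∀ z, g z = 0 → z.re = 0)
    (hgrow : ∀ ε > 0, ∀ᶠ R : ℝ in atTop, ∀ z, ‖z‖ ≤ R → ‖g z‖ ≤ Real.exp (ε * R ^ 2))
    {ε : ℝ} (hε : 0 < ε) :
    ∀ᶠ R : ℝ in atTop, ∃ (F : Finset ℝ) (h : ℂ → ℂ), (∀ γ, γ ∈ F ↔ |γ| ≤ R ∧ g (γ * I) = 0) ∧
      Differentiable ℂ h ∧ (∀ z ∈ ball (0 : ℂ) R, h z ≠ 0) ∧
      (∀ z ∈ ball (0 : ℂ) (R / 8), ‖deriv (logDeriv h) z‖ ≤ ε) ∧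
      ∀ z, g z = (∏ γ ∈ F, (1 - z / (γ * I)) ^ analyticOrderNatAt g (γ * I)) * h z := by
  have hε' : 0 < ε / 512 := by positivity
  have h2R : Tendsto (fun R : ℝ ↦ 2 * R) atTop atTop := tendsto_id.const_mul_atTop (by norm_num)
  have hsq : Tendsto (fun R : ℝ ↦ R ^ 2) atTop atTop := tendsto_pow_atTop (by norm_num)
  filter_upwards [h2R.eventually (hgrow _ hε'), eventually_gt_atTop 0,
    hsq.eventually_ge_atTop (128 * (|Real.log ‖g 0‖| + 1) / ε)] with R hR hR0 hRε
  classical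
  obtain ⟨e, he⟩ : ∃ e : ℝ ↪ ℂ, ∀ γ, e γ = γ * I :=
    ⟨⟨fun γ ↦ γ * I, fun a b hab ↦ by simpa using hab⟩, fun _ ↦ rfl⟩
  have hfin : {γ : ℝ | |γ| ≤ R ∧ g (γ * I) = 0}.Finite := by
    refine Set.Finite.of_finite_image (f := e)
      ((hg.finite_zeros_closedBall hg0 R).subset ?_) e.injective.injOn
    rintro _ ⟨γ, hγ, rfl⟩
    simpa [he] using hγ
  set F := hfin.toFinset with hF
  have hFmem : ∀ γ, γ ∈ F ↔ |γ| ≤ R ∧ g (γ * I) = 0 := fun γ ↦ by simp [hF]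
  have hFne : ∀ γ ∈ F, γ ≠ 0 := by
    rintro γ hγ rfl
    exact hg0 (by simpa using ((hFmem 0).1 hγ).2)
  obtain ⟨h, hh, hhne, hgh⟩ := hg.exists_eq_prod_one_sub_div_pow_mul hg0 (F.map e) (by
    intro w hw
    obtain ⟨γ, hγ, rfl⟩ := Finset.mem_map.1 hw
    simpa [he] using hFne γ hγ)
  simp only [Finset.prod_map] at hgh
  have hh0 : h 0 = g 0 := by rw [hgh]; simp
  have hne : ∀ z ∈ ball (0 : ℂ) R, h z ≠ 0 := fun z hz h0 ↦ by
    have hgz : g z = 0 := by rw [hgh, h0, mul_zero]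
    have hz' : z = e z.im := by
      apply Complex.ext <;> simp [he, hline z hgz]
    refine hhne (e z.im) (Finset.mem_map_of_mem _ ((hFmem _).2 ⟨?_, ?_⟩)) (by rwa [← hz'])
    · exact (abs_im_le_norm z).trans (mem_ball_zero_iff.1 hz).le
    · rwa [← he, ← hz']
  -- The first term is `ε R² / 128`, and for large `R` the others add up to at most as much; hence
  -- `64 M / R² ≤ ε`.
  set M := ε / 512 * (2 * R) ^ 2 + |Real.log ‖g 0‖| + 1 with hM
  have hMpos : 0 < M := by positivity
  have hle : ∀ z ∈ ball (0 : ℂ) R, ‖h z‖ ≤ ‖h 0‖ * Real.exp M := by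
    intro z hz
    have hfr : ∀ y ∈ frontier (ball (0 : ℂ) (2 * R)), ‖h y‖ ≤ Real.exp (ε / 512 * (2 * R) ^ 2) := by
      intro y hy
      rw [frontier_ball _ (by positivity), mem_sphere_zero_iff_norm] at hy
      refine le_trans ?_ (hR y hy.le)
      rw [hgh y, norm_mul, norm_prod]
      refine le_mul_of_one_le_left (norm_nonneg _) ?_
      refine Finset.prod_induction _ (1 ≤ ·) (fun a b ↦ one_le_mul_of_one_le_of_one_le) le_rfl
        fun γ hγ ↦ ?_
      rw [norm_pow]
      refine one_le_pow₀ ?_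
      have h1 := norm_sub_norm_le (y / e γ) 1
      rw [norm_sub_rev, norm_div, hy, norm_one] at h1
      have h2 : ‖e γ‖ = |γ| := by simp [he]
      have h3 : 2 ≤ 2 * R / ‖e γ‖ := by
        rw [h2, le_div_iff₀ (abs_pos.2 (hFne γ hγ))]
        linarith [((hFmem γ).1 hγ).1]
      linarith
    have h1 := norm_le_of_forall_mem_frontier_norm_le isBounded_ball hh.diffContOnCl hfr
      (subset_closure (ball_subset_ball (by linarith) hz))
    refine h1.trans ?_
    have hpos : 0 < ‖h 0‖ := norm_pos_iff.2 (hh0 ▸ hg0)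
    conv_rhs => rw [← Real.exp_log hpos]
    rw [← Real.exp_add, Real.exp_le_exp, hM, hh0]
    linarith [neg_abs_le (Real.log ‖g 0‖)]
  refine ⟨F, h, hFmem, hh, hne, fun z hz ↦ ?_, fun z ↦ by simpa only [he] using hgh z⟩
  refine (norm_deriv_logDeriv_le hh hR0 hMpos hne hle hz).trans ?_
  rw [div_le_iff₀ (by positivity), hM]
  rw [div_le_iff₀ hε] at hRε
  nlinarith

theorem logDeriv_eq_sum_add_logDeriv {F : Finset ℝ} {h : ℂ → ℂ} {m : ℝ → ℕ}
    (hF : ∀ γ ∈ F, γ ≠ 0) (hh : Differentiable ℂ h)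
    (hgh : ∀ z, g z = (∏ γ ∈ F, (1 - z / (γ * I)) ^ m γ) * h z) {z : ℂ} (hz : g z ≠ 0)
    (hzF : ∀ γ ∈ F, z ≠ γ * I) :
    logDeriv g z = ∑ γ ∈ F, (m γ : ℂ) * (1 / (z - γ * I)) + logDeriv h z := by
  have hne : ∀ γ ∈ F, (γ : ℂ) * I ≠ 0 := fun γ hγ ↦ by simpa using hF γ hγ
  have hne' : ∀ γ ∈ F, 1 - z / (γ * I) ≠ 0 := fun γ hγ h0 ↦ hzF γ hγ (by
    have := hne γ hγ
    rw [sub_eq_zero, eq_div_iff this] at h0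
    rw [← h0, one_mul])
  have hz' := hz
  rw [hgh] at hz'
  rw [show g = fun z ↦ (∏ γ ∈ F, (1 - z / (γ * I)) ^ m γ) * h z from funext hgh,
    logDeriv_mul z (left_ne_zero_of_mul hz') (right_ne_zero_of_mul hz') (by fun_prop) (hh z),
    logDeriv_prod (f := fun (γ : ℝ) (z : ℂ) ↦ (1 - z / (γ * I)) ^ m γ)
      (fun γ hγ ↦ pow_ne_zero _ (hne' γ hγ)) (fun γ _ ↦ by fun_prop)]
  congr 1
  refine Finset.sum_congr rfl fun γ hγ ↦ ?_
  rw [logDeriv_fun_pow (by fun_prop), logDeriv_apply]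
  congr 1
  have hd : HasDerivAt (fun z : ℂ ↦ 1 - z / (γ * I)) (-(1 / (γ * I))) z :=
    ((hasDerivAt_id z).div_const _).const_sub 1
  have h1 := sub_ne_zero.2 (hzF γ hγ)
  rw [hd.deriv, div_eq_div_iff (hne' γ hγ) h1]
  have h2 := hne γ hγ
  generalize (γ : ℂ) * I = w at *
  field_simp
  ring

/-- The zeros of an entire function of growth `exp (o(R²))` whose zeros `iγ` are all purely
imaginary satisfy `∑ 1 / γ² < ∞`. -/
theorem summable_order_div_sq (hg : Differentiable ℂ g) (hg0 : g 0 ≠ 0)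
    (hline : ∀ z, g z = 0 → z.re = 0)
    (hgrow : ∀ ε > 0, ∀ᶠ R : ℝ in atTop, ∀ z, ‖z‖ ≤ R → ‖g z‖ ≤ Real.exp (ε * R ^ 2)) :
    Summable fun γ : ℝ ↦ (analyticOrderNatAt g (γ * I) : ℝ) / γ ^ 2 := by
  set m : ℝ → ℕ := fun γ ↦ analyticOrderNatAt g (γ * I) with hm
  refine summable_of_sum_le (c := ‖deriv (logDeriv g) 0‖ + 1) (fun γ ↦ by positivity) fun S ↦ ?_
  have hS : ∀ᶠ R : ℝ in atTop, ∀ γ ∈ S, |γ| ≤ R :=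
    (Finset.eventually_all S).2 fun γ _ ↦ eventually_ge_atTop _
  obtain ⟨R, ⟨F, h, hF, hh, hhne, hder, hgh⟩, hSR, hR0⟩ :=
    ((exists_factorization_ball hg hg0 hline hgrow one_pos).and
      (hS.and (eventually_gt_atTop 0))).exists
  have hFne : ∀ γ ∈ F, γ ≠ 0 := by
    rintro γ hγ rfl
    exact hg0 (by simpa using ((hF 0).1 hγ).2)
  have hsub : ∑ γ ∈ S, (m γ : ℝ) / γ ^ 2 ≤ ∑ γ ∈ F, (m γ : ℝ) / γ ^ 2 := by
    classical
    refine le_trans (Finset.sum_le_sum_of_subset_of_nonneg (Finset.subset_union_left (s₂ := F))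
      fun _ _ _ ↦ by positivity) (le_of_eq (Finset.sum_subset Finset.subset_union_right ?_).symm)
    intro γ hγ hγF
    have : m γ = 0 := by
      by_contra hne
      refine hγF ((hF γ).2 ⟨hSR γ ((Finset.mem_union.1 hγ).resolve_right hγF), ?_⟩)
      exact apply_eq_zero_of_analyticOrderNatAt_ne_zero hne
    simp [this]
  refine hsub.trans ?_
  have hev : logDeriv g =ᶠ[𝓝 0] fun z ↦ ∑ γ ∈ F, (m γ : ℂ) * (1 / (z - γ * I)) + logDeriv h z := by
    filter_upwards [hg.continuous.continuousAt.eventually_ne hg0] with z hz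
    refine logDeriv_eq_sum_add_logDeriv hFne hh hgh hz fun γ hγ h0 ↦ hz ?_
    rw [h0]
    exact ((hF γ).1 hγ).2
  -- At `0` the derivative of `1/(z - iγ)` is `1/γ²`, which is positive because the zeros are
  -- imaginary. Every finite sum is thus bounded by the fixed `|(log g)''(0)|` plus a small error.
  have hd : HasDerivAt (fun z ↦ ∑ γ ∈ F, (m γ : ℂ) * (1 / (z - γ * I)) + logDeriv h z)
      (∑ γ ∈ F, (m γ : ℂ) * (1 / (γ : ℂ) ^ 2) + deriv (logDeriv h) 0) 0 := by
    refine HasDerivAt.add (HasDerivAt.fun_sum fun γ hγ ↦ HasDerivAt.const_mul _ ?_) ?_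
    · have hγ0 : (γ : ℂ) ≠ 0 := by exact_mod_cast hFne γ hγ
      have := ((hasDerivAt_id (0 : ℂ)).sub_const ((γ : ℂ) * I)).inv (by simp [hγ0])
      simp only [one_div]
      refine this.congr_deriv ?_
      simp [mul_pow]
    · exact DifferentiableAt.hasDerivAt
        ((hh.deriv 0).div (hh 0) (hhne 0 (mem_ball_self hR0)))
  have heq := hev.deriv_eq.trans hd.deriv
  have hsum : ((∑ γ ∈ F, (m γ : ℝ) / γ ^ 2 : ℝ) : ℂ)
      = deriv (logDeriv g) 0 - deriv (logDeriv h) 0 := by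
    rw [heq]
    push_cast
    simp [div_eq_mul_inv]
  have hnorm := congrArg norm hsum
  rw [Complex.norm_real, Real.norm_of_nonneg (Finset.sum_nonneg fun γ _ ↦ by positivity)] at hnorm
  rw [hnorm]
  refine (norm_sub_le _ _).trans ?_
  gcongr
  exact hder 0 (mem_ball_self (by positivity))

theorem summable_order_mul_partialFraction {m : ℝ → ℕ}
    (hm : Summable fun γ : ℝ ↦ (m γ : ℝ) / γ ^ 2) (hm0 : m 0 = 0) {z : ℂ} (hz : 0 < z.re) :
    Summable fun γ : ℝ ↦ (m γ : ℂ) * (1 / (z - γ * I) + 1 / (γ * I)) := by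
  refine Summable.of_norm_bounded (hm.mul_left (‖z‖ * (1 + ‖z‖ / z.re))) fun γ ↦ ?_
  rcases eq_or_ne γ 0 with rfl | hγ
  · simp [hm0]
  have hγ' : (γ : ℂ) * I ≠ 0 := by simpa using hγ
  have hre : z.re ≤ ‖z - γ * I‖ := by
    have := abs_re_le_norm (z - γ * I)
    simp only [sub_re, mul_re, ofReal_re, I_re, mul_zero, ofReal_im, I_im, zero_mul, sub_zero]
      at this
    exact (le_abs_self _).trans this
  have hpos : 0 < ‖z - γ * I‖ := hz.trans_le hre
  have hzγ : z - γ * I ≠ 0 := norm_pos_iff.1 hpos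
  have h1 : 1 / (z - γ * I) + 1 / (γ * I) = z / ((γ * I) * (z - γ * I)) := by
    generalize (γ : ℂ) * I = w at *
    field_simp
    ring
  have hn : ‖(γ : ℂ) * I‖ = |γ| := by simp
  rw [h1, norm_mul, norm_div, norm_mul, hn, Complex.norm_natCast]
  -- Since `‖z - iγ‖ ≥ re z`, the triangle inequality makes `‖z - iγ‖` comparable to `|γ|` uniformly
  -- in `γ`.
  have h2 : |γ| ≤ (1 + ‖z‖ / z.re) * ‖z - γ * I‖ := by
    have h3 := norm_sub_le z (z - γ * I)
    rw [sub_sub_cancel, hn] at h3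
    have h4 : ‖z‖ ≤ ‖z‖ / z.re * ‖z - γ * I‖ := by
      rw [div_mul_eq_mul_div, le_div_iff₀ hz]
      gcongr
    linarith
  have hγp : 0 < |γ| := abs_pos.2 hγ
  rw [← sq_abs γ]
  have h5 : ‖z‖ / (|γ| * ‖z - γ * I‖) ≤ ‖z‖ * (1 + ‖z‖ / z.re) / |γ| ^ 2 := by
    rw [div_le_div_iff₀ (by positivity) (by positivity)]
    have := mul_le_mul_of_nonneg_left h2 (mul_nonneg (norm_nonneg z) hγp.le)
    nlinarith
  calc (m γ : ℝ) * (‖z‖ / (|γ| * ‖z - γ * I‖))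
      ≤ m γ * (‖z‖ * (1 + ‖z‖ / z.re) / |γ| ^ 2) := by gcongr
    _ = _ := by ring

/-- Partial fraction expansion of the logarithmic derivative of an entire function of growth
`exp (o(R²))` with purely imaginary zeros. -/
theorem hasSum_logDeriv_sub_logDeriv (hg : Differentiable ℂ g) (hg0 : g 0 ≠ 0)
    (hline : ∀ z, g z = 0 → z.re = 0)
    (hgrow : ∀ ε > 0, ∀ᶠ R : ℝ in atTop, ∀ z, ‖z‖ ≤ R → ‖g z‖ ≤ Real.exp (ε * R ^ 2))
    {z : ℂ} (hz : 0 < z.re) :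
    HasSum (fun γ : ℝ ↦ (analyticOrderNatAt g (γ * I) : ℂ) * (1 / (z - γ * I) + 1 / (γ * I)))
      (logDeriv g z - logDeriv g 0) := by
  set m : ℝ → ℕ := fun γ ↦ analyticOrderNatAt g (γ * I) with hm
  have hmz : ∀ γ : ℝ, g (γ * I) ≠ 0 → m γ = 0 := fun γ hγ ↦ by
    by_contra hne
    exact hγ (apply_eq_zero_of_analyticOrderNatAt_ne_zero hne)
  have hsum := summable_order_mul_partialFraction
    (summable_order_div_sq hg hg0 hline hgrow) (hmz 0 (by simpa using hg0)) hz
  have hgz : g z ≠ 0 := fun h ↦ hz.ne' (hline z h)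
  convert hsum.hasSum using 1
  refine eq_of_forall_dist_le fun ε hε ↦ ?_
  obtain ⟨S, hS⟩ := (Metric.tendsto_atTop.1 hsum.hasSum) (ε / 2) (by positivity)
  -- With this choice the mean value inequality on the ball of radius `R/8` bounds the change of
  -- `h'/h` from `0` to `z` by `ε/2`; the rest of `g'/g` is a partial sum of the series.
  set ε' := ε / 2 / (‖z‖ + 1) with hε'
  have hSR : ∀ᶠ R : ℝ in atTop, ∀ γ ∈ S, |γ| ≤ R :=
    (Finset.eventually_all S).2 fun γ _ ↦ eventually_ge_atTop _
  obtain ⟨R, ⟨F, h, hF, hh, hhne, hder, hgh⟩, hSR, hR0, hRz⟩ :=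
    ((exists_factorization_ball hg hg0 hline hgrow (ε := ε') (by positivity)).and
      (hSR.and ((eventually_gt_atTop 0).and (eventually_gt_atTop (8 * ‖z‖))))).exists
  have hFne : ∀ γ ∈ F, γ ≠ 0 := by
    rintro γ hγ rfl
    exact hg0 (by simpa using ((hF 0).1 hγ).2)
  have hform : ∀ y, g y ≠ 0 →
      logDeriv g y = ∑ γ ∈ F, (m γ : ℂ) * (1 / (y - γ * I)) + logDeriv h y := fun y hy ↦
    logDeriv_eq_sum_add_logDeriv hFne hh hgh hy fun γ hγ h0 ↦ hy (by
      rw [h0]; exact ((hF γ).1 hγ).2)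
  classical
  have hSF : ∑ γ ∈ S ∪ F, (m γ : ℂ) * (1 / (z - γ * I) + 1 / (γ * I))
      = ∑ γ ∈ F, (m γ : ℂ) * (1 / (z - γ * I) + 1 / (γ * I)) := by
    refine (Finset.sum_subset Finset.subset_union_right fun γ hγ hγF ↦ ?_).symm
    rw [hmz γ fun h0 ↦ hγF ((hF γ).2 ⟨hSR γ ((Finset.mem_union.1 hγ).resolve_right hγF), h0⟩)]
    simp
  have h1 := hS (S ∪ F) Finset.subset_union_left
  rw [hSF] at h1
  have h2 : logDeriv g z - logDeriv g 0
      = ∑ γ ∈ F, (m γ : ℂ) * (1 / (z - γ * I) + 1 / (γ * I))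
        + (logDeriv h z - logDeriv h 0) := by
    rw [hform z hgz, hform 0 hg0]
    simp only [zero_sub, mul_add, Finset.sum_add_distrib, one_div, inv_neg, mul_neg,
      Finset.sum_neg_distrib]
    ring
  have h3 : ‖logDeriv h z - logDeriv h 0‖ ≤ ε / 2 := by
    have hsub : ball (0 : ℂ) (R / 8) ⊆ ball 0 R := ball_subset_ball (by linarith)
    have := (convex_ball (0 : ℂ) (R / 8)).norm_image_sub_le_of_norm_deriv_le (𝕜 := ℂ)
      (f := logDeriv h) (C := ε') (x := 0) (y := z)
      (fun y hy ↦ (hh.deriv y).div (hh y) (hhne y (hsub hy))) hder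
      (mem_ball_self (by positivity)) (mem_ball_zero_iff.2 (by linarith))
    rw [sub_zero] at this
    refine this.trans ?_
    rw [hε', div_mul_eq_mul_div, div_le_iff₀ (by positivity)]
    nlinarith [norm_nonneg z]
  rw [h2, dist_eq_norm]
  rw [dist_eq_norm] at h1
  calc _ = ‖(∑ γ ∈ F, (m γ : ℂ) * (1 / (z - γ * I) + 1 / (γ * I))
          - ∑' γ : ℝ, (m γ : ℂ) * (1 / (z - γ * I) + 1 / (γ * I)))
          + (logDeriv h z - logDeriv h 0)‖ := by congr 1; ring
    _ ≤ ε / 2 + ε / 2 := (norm_add_le _ _).trans (add_le_add h1.le h3)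
    _ = ε := by ring

end LineZeros

end

/-! ### Laplace transforms and Fourier uniqueness -/

section

open Complex Metric Filter Topology MeasureTheory
open scoped FourierTransform

theorem integrable_exp_neg_abs : Integrable fun u : ℝ ↦ Real.exp (-|u|) := by
  have h1 : IntegrableOn (fun u : ℝ ↦ Real.exp (-|u|)) (Set.Ioi 0) :=
    (integrableOn_exp_neg_Ioi 0).congr_fun (fun u (hu : 0 < u) ↦ by simp [abs_of_pos hu])
      measurableSet_Ioi
  have h2 : IntegrableOn (fun u : ℝ ↦ Real.exp (-|u|)) (Set.Iic 0) :=
    (integrableOn_exp_Iic 0).congr_fun (fun u (hu : u ≤ 0) ↦ by simp [abs_of_nonpos hu])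
      measurableSet_Iic
  have := h2.union h1
  rwa [Set.Iic_union_Ioi, integrableOn_univ] at this

/-- A continuous integrable function whose Fourier transform vanishes is zero. -/
theorem eq_zero_of_forall_integral_mul_exp_eq_zero {h : ℝ → ℂ} (hc : Continuous h)
    (hi : Integrable h) (h0 : ∀ y : ℝ, ∫ u : ℝ, h u * cexp (-(y * u * I)) = 0) : h = 0 := by
  have hF : 𝓕 h = 0 := by
    ext w
    rw [Real.fourier_real_eq_integral_exp_smul, Pi.zero_apply, ← h0 (2 * Real.pi * w)]
    congr 1
    ext u
    rw [smul_eq_mul, mul_comm]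
    congr 2
    push_cast
    ring
  have := hc.fourierInv_fourier_eq hi (by rw [hF]; exact integrable_zero _ _ _)
  rw [← this, hF]
  ext v
  simp [Real.fourierInv_eq]

section Series

variable {ι : Type*} {F : ι → ℝ → ℂ} {K : ι → ℝ}

theorem continuous_tsum_of_le_exp_neg_abs (hF : ∀ i, Continuous (F i)) (hK : Summable K)
    (hK0 : ∀ i, 0 ≤ K i) (hle : ∀ i u, ‖F i u‖ ≤ K i * Real.exp (-|u|)) :
    Continuous fun u ↦ ∑' i, F i u :=
  continuous_tsum hF hK fun i u ↦ (hle i u).trans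
    (mul_le_of_le_one_right (hK0 i) (Real.exp_le_one_iff.2 (neg_nonpos.2 (abs_nonneg u))))

theorem integrable_of_le_exp_neg_abs {f : ℝ → ℂ} (hf : Continuous f) {k : ℝ}
    (hle : ∀ u, ‖f u‖ ≤ k * Real.exp (-|u|)) : Integrable f :=
  (integrable_exp_neg_abs.const_mul k).mono' hf.aestronglyMeasurable (ae_of_all _ hle)

theorem integrable_tsum_of_le_exp_neg_abs (hF : ∀ i, Continuous (F i)) (hK : Summable K)
    (hK0 : ∀ i, 0 ≤ K i) (hle : ∀ i u, ‖F i u‖ ≤ K i * Real.exp (-|u|)) :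
    Integrable fun u ↦ ∑' i, F i u := by
  refine integrable_of_le_exp_neg_abs (k := ∑' i, K i)
    (continuous_tsum_of_le_exp_neg_abs hF hK hK0 hle) fun u ↦ ?_
  rw [← tsum_mul_right]
  exact tsum_of_norm_bounded (hK.mul_right _).hasSum fun i ↦ hle i u

theorem hasSum_integral_mul_exp [Countable ι] (hF : ∀ i, Continuous (F i)) (hK : Summable K)
    (hle : ∀ i u, ‖F i u‖ ≤ K i * Real.exp (-|u|)) (y : ℝ) :
    HasSum (fun i ↦ ∫ u : ℝ, F i u * cexp (-(y * u * I)))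
      (∫ u : ℝ, (∑' i, F i u) * cexp (-(y * u * I))) := by
  have hn : ∀ u : ℝ, ‖cexp (-(y * u * I))‖ = 1 := fun u ↦ by
    rw [Complex.norm_exp]; simp
  have hle' : ∀ i u, ‖F i u * cexp (-(y * u * I))‖ ≤ K i * Real.exp (-|u|) := fun i u ↦ by
    rw [norm_mul, hn, mul_one]; exact hle i u
  have hfint : ∀ i, Integrable fun u : ℝ ↦ F i u * cexp (-(y * u * I)) := fun i ↦
    integrable_of_le_exp_neg_abs ((hF i).mul (by fun_prop)) (hle' i)
  simp_rw [← tsum_mul_right]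
  refine hasSum_integral_of_summable_integral_norm hfint ?_
  refine Summable.of_nonneg_of_le (fun i ↦ integral_nonneg fun u ↦ norm_nonneg _) (fun i ↦ ?_)
    (hK.mul_right (∫ u : ℝ, Real.exp (-|u|)))
  rw [← integral_const_mul]
  exact integral_mono (hfint i).norm (integrable_exp_neg_abs.const_mul _) (hle' i)

end Series

theorem integral_Ioi_mul_cexp_neg {z : ℂ} (hz : 0 < z.re) :
    ∫ u : ℝ in Set.Ioi 0, (u : ℂ) * cexp (-z * u) = 1 / z ^ 2 := by
  have hz0 : z ≠ 0 := fun h ↦ by simp [h] at hz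
  have hd : ∀ u ∈ Set.Ici (0 : ℝ), HasDerivAt
      (fun u : ℝ ↦ -((u : ℂ) / z + 1 / z ^ 2) * cexp (-z * u)) ((u : ℂ) * cexp (-z * u)) u := by
    intro u _
    have h1 : HasDerivAt (fun u : ℝ ↦ (u : ℂ)) 1 u := Complex.ofRealCLM.hasDerivAt
    have := ((h1.div_const z).add_const (1 / z ^ 2)).fun_neg.fun_mul (h1.const_mul (-z)).cexp
    refine this.congr_deriv ?_
    field_simp
    ring
  have hnorm : ∀ u : ℝ, ‖cexp (-z * u)‖ = Real.exp (-z.re * u) := fun u ↦ by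
    rw [Complex.norm_exp]; simp
  have hfint : IntegrableOn (fun u : ℝ ↦ (u : ℂ) * cexp (-z * u)) (Set.Ioi 0) := by
    have h1 := integrableOn_rpow_mul_exp_neg_mul_rpow (s := 1) (p := 1) (by norm_num) one_pos hz
    refine Integrable.mono' h1 (Continuous.aestronglyMeasurable (by fun_prop)) ?_
    refine (ae_restrict_iff' measurableSet_Ioi).2 (ae_of_all _ fun u (hu : 0 < u) ↦ ?_)
    rw [norm_mul, hnorm, Complex.norm_real, Real.norm_of_nonneg hu.le, Real.rpow_one]
  have hlim : Tendsto (fun u : ℝ ↦ -((u : ℂ) / z + 1 / z ^ 2) * cexp (-z * u)) atTop (𝓝 0) := by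
    rw [tendsto_zero_iff_norm_tendsto_zero]
    have e0 := Real.tendsto_pow_mul_exp_neg_atTop_nhds_zero 0
    have e1 := Real.tendsto_pow_mul_exp_neg_atTop_nhds_zero 1
    have hs : Tendsto (fun u : ℝ ↦ z.re * u) atTop atTop := tendsto_id.const_mul_atTop hz
    have h2 := (((e1.comp hs).const_mul (1 / (z.re * ‖z‖))).add
      ((e0.comp hs).const_mul (1 / ‖z‖ ^ 2)))
    simp only [mul_zero, add_zero] at h2
    refine squeeze_zero' (Eventually.of_forall fun u ↦ norm_nonneg _) ?_ h2
    filter_upwards [eventually_gt_atTop 0] with u hu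
    rw [norm_mul, hnorm, norm_neg]
    have h3 : ‖(u : ℂ) / z + 1 / z ^ 2‖ ≤ u / ‖z‖ + 1 / ‖z‖ ^ 2 := by
      refine (norm_add_le _ _).trans (le_of_eq ?_)
      simp [abs_of_pos hu]
    refine (mul_le_mul_of_nonneg_right h3 (Real.exp_pos _).le).trans (le_of_eq ?_)
    have : ‖z‖ ≠ 0 := norm_ne_zero_iff.2 hz0
    simp only [Function.comp_apply, pow_one, pow_zero, neg_mul]
    field_simp
  rw [integral_Ioi_of_hasDerivAt_of_tendsto' hd hfint hlim]
  simp

theorem integral_max_sub_mul_cexp_neg {z : ℂ} (hz : 0 < z.re) (L : ℝ) :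
    ∫ u : ℝ, ((max (u - L) 0 : ℝ) : ℂ) * cexp (-z * u) = cexp (-z * L) / z ^ 2 := by
  have h1 : ∫ u : ℝ, ((max u 0 : ℝ) : ℂ) * cexp (-z * u) = 1 / z ^ 2 := by
    rw [← integral_Ioi_mul_cexp_neg hz, ← setIntegral_eq_integral_of_forall_compl_eq_zero
      (s := Set.Ioi (0 : ℝ))]
    · refine setIntegral_congr_fun measurableSet_Ioi fun u (hu : 0 < u) ↦ ?_
      simp only [max_eq_left hu.le]
    · intro u hu
      rw [max_eq_right (not_lt.1 hu)]
      simp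
  have h2 := integral_sub_right_eq_self
    (fun u : ℝ ↦ ((max u 0 : ℝ) : ℂ) * cexp (-z * u) * cexp (-z * L)) (μ := volume) L
  rw [integral_mul_const _ (fun u : ℝ ↦ ((max u 0 : ℝ) : ℂ) * cexp (-z * u)), h1] at h2
  rw [div_eq_mul_one_div, mul_comm, ← h2]
  congr 1
  ext u
  rw [mul_assoc, ← Complex.exp_add]
  congr 2
  push_cast
  ring

theorem integral_one_sub_cexp_mul_cexp_neg {z a : ℂ} (hz : 0 < z.re) (ha : 0 < a.re) :
    ∫ u : ℝ, (1 - cexp (-a * (max u 0 : ℝ))) * cexp (-z * u) = 1 / z - 1 / (z + a) := by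
  have hza : (-(z + a)).re < 0 := by simp; linarith
  have hz' : (-z).re < 0 := by simpa using hz
  rw [← setIntegral_eq_integral_of_forall_compl_eq_zero (s := Set.Ioi (0 : ℝ))]
  · have h1 : ∫ u : ℝ in Set.Ioi 0, (1 - cexp (-a * (max u 0 : ℝ))) * cexp (-z * u) =
        ∫ u : ℝ in Set.Ioi 0, (cexp (-z * u) - cexp (-(z + a) * u)) := by
      refine setIntegral_congr_fun measurableSet_Ioi fun u (hu : 0 < u) ↦ ?_
      simp only [max_eq_left hu.le]
      rw [sub_mul, one_mul, ← Complex.exp_add]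
      congr 2
      ring
    rw [h1, integral_sub (integrableOn_exp_mul_complex_Ioi hz' 0)
      (integrableOn_exp_mul_complex_Ioi hza 0), integral_exp_mul_complex_Ioi hz',
      integral_exp_mul_complex_Ioi hza]
    simp only [ofReal_zero, mul_zero, Complex.exp_zero, neg_div_neg_eq]
  · intro u hu
    rw [max_eq_right (not_lt.1 hu)]
    simp

/-- For `L = log n` the factor `exp (-L)` is `1/n`, which yields a majorant summable over `n` and
integrable in `u` at once. -/
theorem max_sub_mul_exp_le {L u : ℝ} (hL : 0 ≤ L) :
    max (u - L) 0 * Real.exp (-2 * u) ≤ Real.exp (-L) * Real.exp (-|u|) := by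
  rcases le_total u L with h | h
  · rw [max_eq_right (by linarith), zero_mul]; positivity
  · rw [max_eq_left (by linarith), abs_of_nonneg (hL.trans h)]
    have h1 : Real.exp (-2 * u) = Real.exp (-L) * Real.exp (-u) * Real.exp (-(u - L)) := by
      rw [← Real.exp_add, ← Real.exp_add]; congr 1; ring
    have h2 : (u - L) * Real.exp (-(u - L)) ≤ 1 := by
      rw [Real.exp_neg, ← div_eq_mul_inv, div_le_one (Real.exp_pos _)]
      linarith [Real.add_one_le_exp (u - L)]
    rw [h1]
    calc (u - L) * (Real.exp (-L) * Real.exp (-u) * Real.exp (-(u - L)))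
        = Real.exp (-L) * Real.exp (-u) * ((u - L) * Real.exp (-(u - L))) := by ring
      _ ≤ Real.exp (-L) * Real.exp (-u) * 1 := by gcongr
      _ = _ := mul_one _

/-- If the Dirichlet series `∑ b n * n ^ (-z)` has a partial fraction expansion on the line
`re z = 2`, then its weighted partial sums are given by an explicit formula. -/
theorem tsum_mul_max_sub_log_eq {ι : Type*} [Countable ι] {b : ℕ → ℂ} {w : ι → ℝ} {a : ι → ℂ}
    {B : ℂ} (hb0 : b 0 = 0) (hb : Summable fun n : ℕ ↦ ‖b n‖ / n) (ha : ∀ i, 0 < (a i).re)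
    (hw : Summable fun i ↦ |w i| / ‖a i‖ ^ 2)
    (h : ∀ z : ℂ, z.re = 2 → ∑' n : ℕ, b n * cexp (-z * Real.log n)
      = B + ∑' i, (w i : ℂ) * (1 / a i - 1 / (z + a i))) {u : ℝ} (hu : 0 ≤ u) :
    ∑' n : ℕ, b n * (max (u - Real.log n) 0 : ℝ)
      = B * u + ∑' i, (w i : ℂ) * ((1 - cexp (-a i * u)) / a i ^ 2) := by
  -- The factor `exp (-2u)` turns Laplace transforms on `re z = 2` into Fourier transforms; the
  -- truncations `max · 0` extend everything by zero to `u < 0`.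
  set F : ℕ → ℝ → ℂ := fun n u ↦
    b n * ((max (u - Real.log n) 0 : ℝ) : ℂ) * cexp (-2 * u) with hF
  set G : ι → ℝ → ℂ := fun i u ↦
    (w i : ℂ) * ((1 - cexp (-a i * (max u 0 : ℝ))) / a i ^ 2) * cexp (-2 * u) with hG
  set E : ℝ → ℂ := fun u ↦ ((max u 0 : ℝ) : ℂ) * cexp (-2 * u) with hE
  have hnexp : ∀ u : ℝ, ‖cexp (-2 * u)‖ = Real.exp (-2 * u) := fun u ↦ by
    rw [Complex.norm_exp]; simp
  have hFc : ∀ n, Continuous (F n) := fun n ↦ by fun_prop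
  have hGc : ∀ i, Continuous (G i) := fun i ↦ by fun_prop
  have hEc : Continuous E := by fun_prop
  have hFle : ∀ n u, ‖F n u‖ ≤ (‖b n‖ / n) * Real.exp (-|u|) := by
    intro n u
    rcases Nat.eq_zero_or_pos n with rfl | hn
    · simp [hF, hb0]
    have hn' : (0 : ℝ) < n := by exact_mod_cast hn
    have := max_sub_mul_exp_le (u := u) (Real.log_natCast_nonneg n)
    rw [Real.exp_neg (Real.log n), Real.exp_log hn'] at this
    simp only [hF]
    rw [norm_mul, norm_mul, hnexp, Complex.norm_real, Real.norm_of_nonneg (le_max_right _ _),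
      mul_assoc, div_eq_mul_inv, mul_assoc]
    gcongr
  have hGle : ∀ i u, ‖G i u‖ ≤ (|w i| / ‖a i‖ ^ 2 * 2) * Real.exp (-|u|) := by
    intro i u
    rcases le_or_gt u 0 with hu | hu
    · simp only [hG, max_eq_right hu]
      simp only [ofReal_zero, mul_zero, Complex.exp_zero, sub_self, zero_div, zero_mul, norm_zero]
      positivity
    · simp only [hG, max_eq_left hu.le]
      rw [norm_mul, norm_mul, hnexp, norm_div, norm_pow, Complex.norm_real, abs_of_pos hu,
        Real.norm_eq_abs]
      have h1 : ‖1 - cexp (-a i * u)‖ ≤ 2 := by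
        refine (norm_sub_le _ _).trans ?_
        rw [Complex.norm_exp, norm_one]
        have : Real.exp (-a i * u).re ≤ 1 := by
          rw [Real.exp_le_one_iff]
          simp
          have := ha i
          positivity
        linarith
      have h2 : Real.exp (-2 * u) ≤ Real.exp (-u) := Real.exp_le_exp.2 (by linarith)
      calc |w i| * (‖1 - cexp (-a i * u)‖ / ‖a i‖ ^ 2) * Real.exp (-2 * u)
          ≤ |w i| * (2 / ‖a i‖ ^ 2) * Real.exp (-u) := by gcongr
        _ = _ := by ring
  have hEle : ∀ u, ‖E u‖ ≤ 1 * Real.exp (-|u|) := by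
    intro u
    have := max_sub_mul_exp_le (u := u) le_rfl
    simp only [hE]
    rw [norm_mul, hnexp, Complex.norm_real, Real.norm_of_nonneg (le_max_right _ _)]
    simpa using this
  have hb' : ∀ n : ℕ, 0 ≤ ‖b n‖ / n := fun n ↦ by positivity
  have hw' : ∀ i, 0 ≤ |w i| / ‖a i‖ ^ 2 * 2 := fun i ↦ by positivity
  have hFi := integrable_tsum_of_le_exp_neg_abs hFc hb hb' hFle
  have hGi := integrable_tsum_of_le_exp_neg_abs hGc (hw.mul_right 2) hw' hGle
  have hEi := integrable_of_le_exp_neg_abs hEc hEle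
  set D : ℝ → ℂ := fun u ↦ (∑' n, F n u - B * E u) - ∑' i, G i u with hD
  have hzero : D = 0 := by
    refine eq_zero_of_forall_integral_mul_exp_eq_zero ?_ ((hFi.sub (hEi.const_mul B)).sub hGi)
      fun y ↦ ?_
    · exact ((continuous_tsum_of_le_exp_neg_abs hFc hb hb' hFle).sub (hEc.const_mul B)).sub
        (continuous_tsum_of_le_exp_neg_abs hGc (hw.mul_right 2) hw' hGle)
    set z : ℂ := 2 + y * I with hz
    have hzre : z.re = 2 := by simp [hz]
    have hzpos : 0 < z.re := by rw [hzre]; norm_num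
    have hz0 : z ≠ 0 := fun h ↦ by simp [h] at hzpos
    have hexp : ∀ u : ℝ, cexp (-2 * u) * cexp (-(y * u * I)) = cexp (-z * u) := fun u ↦ by
      rw [← Complex.exp_add, hz]; congr 1; ring
    have hfint : ∀ {f : ℝ → ℂ}, Integrable f →
        Integrable fun u : ℝ ↦ f u * cexp (-(y * u * I)) := by
      intro f hf
      refine hf.mul_bdd (c := 1) (Continuous.aestronglyMeasurable (by fun_prop))
        (ae_of_all _ fun u ↦ ?_)
      rw [Complex.norm_exp]; simp
    have hIF : ∀ n, ∫ u : ℝ, F n u * cexp (-(y * u * I))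
        = b n * cexp (-z * Real.log n) * (1 / z ^ 2) := fun n ↦ by
      have h1 : ∀ u : ℝ, F n u * cexp (-(y * u * I))
          = b n * (((max (u - Real.log n) 0 : ℝ) : ℂ) * cexp (-z * u)) := fun u ↦ by
        rw [← hexp]; simp only [hF]; ring
      simp_rw [h1]
      rw [integral_const_mul, integral_max_sub_mul_cexp_neg hzpos]
      ring
    have hIE : ∫ u : ℝ, E u * cexp (-(y * u * I)) = 1 / z ^ 2 := by
      have := integral_max_sub_mul_cexp_neg hzpos 0
      simp only [sub_zero, ofReal_zero, mul_zero, Complex.exp_zero] at this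
      rw [← this]
      congr 1
      ext u
      rw [← hexp, ← mul_assoc]
    -- This rests on `(1/z - 1/(z+a)) / a² = (1/a - 1/(z+a)) / z²`. Every transform then carries the
    -- factor `1/z²`, and what remains is the hypothesis `h` at `z`.
    have hIG : ∀ i, ∫ u : ℝ, G i u * cexp (-(y * u * I))
        = (w i : ℂ) * (1 / a i - 1 / (z + a i)) * (1 / z ^ 2) := fun i ↦ by
      have hai : a i ≠ 0 := fun h ↦ by simpa [h] using ha i
      have hzai : z + a i ≠ 0 := fun h ↦ by
        have := congrArg re h
        simp only [add_re, zero_re] at this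
        linarith [ha i]
      have h1 : ∀ u : ℝ, G i u * cexp (-(y * u * I))
          = (w i : ℂ) / a i ^ 2 * ((1 - cexp (-a i * (max u 0 : ℝ))) * cexp (-z * u)) := fun u ↦ by
        rw [← hexp]; simp only [hG]; ring
      simp_rw [h1]
      rw [integral_const_mul, integral_one_sub_cexp_mul_cexp_neg hzpos (ha i)]
      field_simp
      ring
    have hSF := hasSum_integral_mul_exp hFc hb hFle y
    have hSG := hasSum_integral_mul_exp hGc (hw.mul_right 2) hGle y
    simp only [hIF] at hSF
    simp only [hIG] at hSG
    have hDu : ∀ u : ℝ, D u * cexp (-(y * u * I)) = (∑' n, F n u) * cexp (-(y * u * I))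
        - B * (E u * cexp (-(y * u * I))) - (∑' i, G i u) * cexp (-(y * u * I)) := fun u ↦ by
      simp only [hD]; ring
    simp_rw [hDu]
    have hi1 : Integrable fun u : ℝ ↦ (∑' n, F n u) * cexp (-(y * u * I))
        - B * (E u * cexp (-(y * u * I))) := (hfint hFi).sub ((hfint hEi).const_mul B)
    rw [integral_sub hi1 (hfint hGi), integral_sub (hfint hFi) ((hfint hEi).const_mul B),
      integral_const_mul, hIE, ← hSF.tsum_eq,
      ← hSG.tsum_eq, tsum_mul_right, tsum_mul_right, h z hzre]
    ring
  have hDu := congrFun hzero u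
  simp only [hD, hF, hG, hE, Pi.zero_apply, max_eq_left hu, tsum_mul_right] at hDu
  have hne := Complex.exp_ne_zero (-2 * (u : ℂ))
  refine mul_right_cancel₀ hne ?_
  linear_combination hDu

end

/-! ### Partial fractions and size of the digamma function -/

section

open Complex Metric Filter Topology

theorem ne_neg_natCast_of_re_pos {s : ℂ} (hs : 0 < s.re) (m : ℕ) : s ≠ -m := fun h ↦ by
  rw [h, neg_re, natCast_re] at hs
  linarith [(Nat.cast_nonneg m : (0 : ℝ) ≤ m)]

theorem Complex.digamma_add_natCast {s : ℂ} (hs : 0 < s.re) (N : ℕ) :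
    digamma (s + N) = digamma s + ∑ k ∈ Finset.range N, 1 / (s + k) := by
  induction N with
  | zero => simp
  | succ N ih =>
    have hsN : 0 < (s + N).re := by
      rw [add_re, natCast_re]; positivity
    rw [Finset.sum_range_succ, ← add_assoc, ← ih, Nat.cast_succ, ← add_assoc,
      digamma_apply_add_one _ (ne_neg_natCast_of_re_pos hsN), one_div]

theorem Real.deriv_log_Gamma_eq_digamma {x : ℝ} (hx : 0 < x) :
    ((deriv (Real.log ∘ Real.Gamma) x : ℝ) : ℂ) = digamma x := by
  have hne : ∀ m : ℕ, x ≠ -m := fun m ↦ by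
    have : (0 : ℝ) ≤ m := Nat.cast_nonneg m
    linarith
  have hd := (Real.differentiableAt_Gamma hne).hasDerivAt
  have h1 := (hd.log (Real.Gamma_pos_of_pos hx).ne').deriv
  have h2 : HasDerivAt (fun y : ℝ ↦ ((Real.Gamma y : ℝ) : ℂ)) (deriv Complex.Gamma x) x := by
    have := (Complex.differentiableAt_Gamma (x : ℂ) fun m h ↦
      hne m (by exact_mod_cast h)).hasDerivAt
    simpa only [Complex.Gamma_ofReal] using this.comp_ofReal
  have h3 := hd.ofReal_comp.unique h2
  rw [Function.comp_def, h1, digamma_def, logDeriv_apply, ← h3, Complex.Gamma_ofReal]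
  push_cast
  rfl

/-- Log-convexity of `Γ` makes `ψ` monotone on the positive reals, so the difference lies between
`0` and `ψ(N+2) - ψ(N+1) = 1/(N+1)`. -/
theorem Complex.tendsto_digamma_add_natCast_sub {x : ℝ} (h1 : 1 ≤ x) (h2 : x ≤ 2) :
    Tendsto (fun N : ℕ ↦ digamma (x + N) - digamma (1 + N)) atTop (𝓝 0) := by
  set φ : ℝ → ℝ := deriv (Real.log ∘ Real.Gamma) with hφ
  have hmono : MonotoneOn φ (Set.Ioi 0) := by
    refine Real.convexOn_log_Gamma.monotoneOn_deriv fun x (hx : 0 < x) ↦ ?_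
    exact (Real.differentiableAt_Gamma fun m ↦ by
      have : (0 : ℝ) ≤ m := Nat.cast_nonneg m
      linarith).log (Real.Gamma_pos_of_pos hx).ne'
  have hd : ∀ y : ℝ, 0 < y → digamma y = φ y := fun y hy ↦
    (Real.deriv_log_Gamma_eq_digamma hy).symm
  rw [tendsto_zero_iff_norm_tendsto_zero]
  refine squeeze_zero (fun N ↦ norm_nonneg _) (fun N ↦ ?_)
    (tendsto_one_div_add_atTop_nhds_zero_nat (𝕜 := ℝ))
  have hN : (0 : ℝ) ≤ N := Nat.cast_nonneg N
  have e1 : digamma ((x : ℂ) + N) = φ (x + N) := by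
    rw [← hd _ (by linarith)]; push_cast; rfl
  have e2 : digamma (1 + N) = φ (1 + N) := by
    rw [← hd _ (by linarith)]; push_cast; rfl
  have e3 : φ (1 + N + 1) = φ (1 + N) + 1 / (N + 1) := by
    have h := digamma_apply_add_one (1 + N) (ne_neg_natCast_of_re_pos (by simp; positivity))
    rw [e2] at h
    have h' : digamma (1 + N + 1) = φ (1 + N + 1) := by
      rw [← hd _ (by linarith)]; push_cast; rfl
    rw [h'] at h
    have h'' : ((φ (1 + N + 1) : ℝ) : ℂ) = ((φ (1 + N) + 1 / (N + 1) : ℝ) : ℂ) := by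
      rw [h]; push_cast; rw [one_div, add_comm (N : ℂ) 1]
    exact_mod_cast h''
  rw [e1, e2, ← ofReal_sub, Complex.norm_real, Real.norm_eq_abs, abs_of_nonneg]
  · have := hmono (a := x + N) (b := 1 + N + 1) (Set.mem_Ioi.2 (by linarith))
      (Set.mem_Ioi.2 (by linarith)) (by linarith)
    linarith
  · have := hmono (a := 1 + N) (b := x + N) (Set.mem_Ioi.2 (by linarith))
      (Set.mem_Ioi.2 (by linarith)) (by linarith)
    linarith

theorem summable_one_div_add_natCast_sq {δ : ℝ} (hδ : 0 < δ) :
    Summable fun n : ℕ ↦ 1 / (δ + n) ^ 2 := by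
  have := Real.summable_one_div_nat_add_rpow δ 2
  simp only [Nat.one_lt_ofNat, iff_true] at this
  refine this.congr fun n ↦ ?_
  rw [abs_of_pos (by positivity), add_comm]
  norm_cast

theorem norm_add_natCast_ge {δ : ℝ} {z : ℂ} (hz : δ ≤ z.re) (n : ℕ) : δ + n ≤ ‖z + n‖ := by
  have := re_le_norm (z + n)
  rw [add_re, natCast_re] at this
  linarith

theorem summable_one_div_sub_one_div {z w : ℂ} (hz : 0 < z.re) (hw : 0 < w.re) :
    Summable fun n : ℕ ↦ 1 / (w + n) - 1 / (z + n) := by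
  set δ := min z.re w.re with hδ
  have hδ0 : 0 < δ := lt_min hz hw
  refine Summable.of_norm_bounded ((summable_one_div_add_natCast_sq hδ0).mul_left ‖z - w‖)
    fun n ↦ ?_
  have h1 := norm_add_natCast_ge (min_le_left z.re w.re) n
  have h2 := norm_add_natCast_ge (min_le_right z.re w.re) n
  rw [← hδ] at h1 h2
  have hn : 0 < δ + n := by positivity
  have hz0 : z + n ≠ 0 := norm_pos_iff.1 (hn.trans_le h1)
  have hw0 : w + n ≠ 0 := norm_pos_iff.1 (hn.trans_le h2)
  have e : 1 / (w + n) - 1 / (z + n) = (z - w) / ((w + n) * (z + n)) := by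
    field_simp
    ring
  rw [e, norm_div, norm_mul, mul_one_div, sq]
  gcongr

/-- Partial fraction expansion of the digamma function. -/
theorem Complex.hasSum_digamma_sub_digamma {z w : ℂ} (hz : 0 < z.re) (hw : 0 < w.re) :
    HasSum (fun n : ℕ ↦ 1 / (w + n) - 1 / (z + n)) (digamma z - digamma w) := by
  set D : ℂ → ℂ := fun z ↦ ∑' n : ℕ, (1 / (1 + n : ℂ) - 1 / (z + n)) with hD
  have hU : IsOpen {z : ℂ | 0 < z.re} := isOpen_lt continuous_const continuous_re
  have hUc : IsPreconnected {z : ℂ | 0 < z.re} := (convex_halfSpace_re_gt 0).isPreconnected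
  have hDd : DifferentiableOn ℂ D {z : ℂ | 0 < z.re} := by
    intro z (hz : 0 < z.re)
    set δ := min (z.re / 2) (1 / 2) with hδ
    have hδ0 : 0 < δ := by positivity
    have hne : ∀ (n : ℕ) (y : ℂ), δ < y.re → y + n ≠ 0 := fun n y hy ↦
      norm_pos_iff.1 (lt_of_lt_of_le (by positivity) (norm_add_natCast_ge hy.le n))
    refine (hasDerivAt_tsum_of_isPreconnected
      (g := fun (n : ℕ) (z : ℂ) ↦ 1 / (1 + n : ℂ) - 1 / (z + n)) (t := {y : ℂ | δ < y.re}) (y₀ := 1)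
      (summable_one_div_add_natCast_sq hδ0) (isOpen_lt continuous_const continuous_re)
      (convex_halfSpace_re_gt δ).isPreconnected (g' := fun (n : ℕ) (y : ℂ) ↦ 1 / (y + n) ^ 2)
      (fun n y hy ↦ ?_) (fun n y hy ↦ ?_) ?_ ?_ ?_).differentiableAt.differentiableWithinAt
    · have := (((hasDerivAt_id y).add_const (n : ℂ)).fun_inv (hne n y hy)).const_sub
        (1 / (1 + n : ℂ))
      simp only [one_div]
      simp only [one_div] at this
      refine this.congr_deriv ?_
      simp [neg_div]
    · rw [norm_div, norm_one, norm_pow]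
      gcongr
      exact norm_add_natCast_ge (le_of_lt hy) n
    · simp only [Set.mem_ofPred_eq, one_re]
      exact (min_le_right _ _).trans_lt (by norm_num)
    · simp only [sub_self]
      exact summable_zero
    · have := min_le_left (z.re / 2) (1 / 2)
      exact (by linarith : δ < z.re)
  have hψd : DifferentiableOn ℂ digamma {z : ℂ | 0 < z.re} := by
    have hΓ : DifferentiableOn ℂ Complex.Gamma {z : ℂ | 0 < z.re} := fun z (hz : 0 < z.re) ↦
      (differentiableAt_Gamma z (ne_neg_natCast_of_re_pos hz)).differentiableWithinAt
    intro z (hz : 0 < z.re)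
    exact ((hΓ.deriv hU).div hΓ fun z (hz : 0 < z.re) ↦ Gamma_ne_zero_of_re_pos hz) z hz
  -- On the real interval `[1, 2]` the recurrence for `ψ` and the preceding limit give the identity;
  -- the points `1 + 1/(n+1)` accumulate at `1`, so it extends to the half-plane.
  have hp : Set.EqOn (fun z ↦ digamma z - D z) (fun _ ↦ digamma 1) {z : ℂ | 0 < z.re} := by
    refine AnalyticOnNhd.eqOn_of_preconnected_of_frequently_eq (z₀ := 1)
      ((hψd.sub hDd).analyticOnNhd hU) analyticOnNhd_const hUc (by simp) ?_
    have hreal : ∀ x : ℝ, 1 ≤ x → x ≤ 2 → digamma x - D x = digamma 1 := by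
      intro x h1 h2
      have hx : 0 < (x : ℂ).re := by rw [ofReal_re]; linarith
      have hlim := Complex.tendsto_digamma_add_natCast_sub h1 h2
      have hs := (summable_one_div_sub_one_div hx (w := 1) (by simp)).hasSum.tendsto_sum_nat
      have hs' : Tendsto (fun N : ℕ ↦ digamma (x + N) - digamma (1 + N)) atTop
          (𝓝 (digamma x - digamma 1 - D x)) := by
        refine (tendsto_const_nhds.sub hs).congr fun N ↦ ?_
        rw [digamma_add_natCast hx, digamma_add_natCast (s := 1) (by simp),
          Finset.sum_sub_distrib]
        ring
      linear_combination tendsto_nhds_unique hs' hlim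
    have hseq : Tendsto (fun n : ℕ ↦ ((1 + 1 / ((n : ℝ) + 1) : ℝ) : ℂ)) atTop (𝓝[≠] 1) := by
      refine tendsto_nhdsWithin_iff.2 ⟨?_, Eventually.of_forall fun n ↦ ?_⟩
      · have := (tendsto_one_div_add_atTop_nhds_zero_nat (𝕜 := ℝ)).const_add 1
        rw [add_zero] at this
        have := (continuous_ofReal.tendsto (1 : ℝ)).comp this
        rwa [ofReal_one] at this
      · have : 0 < 1 / ((n : ℝ) + 1) := by positivity
        intro h
        rw [Set.mem_singleton_iff] at h
        have h' : (1 + 1 / ((n : ℝ) + 1) : ℝ) = 1 := by exact_mod_cast h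
        linarith
    refine hseq.frequently (Eventually.of_forall fun n ↦ ?_).frequently
    have h0 : 0 < 1 / ((n : ℝ) + 1) := by positivity
    have h1 : 1 / ((n : ℝ) + 1) ≤ 1 := by
      rw [div_le_one (by positivity)]
      linarith [(Nat.cast_nonneg n : (0 : ℝ) ≤ n)]
    exact hreal _ (by linarith) (by linarith)
  have e1 := hp hz
  have e2 := hp hw
  simp only at e1 e2
  have h1 : (0 : ℝ) < (1 : ℂ).re := by simp
  have hs := (summable_one_div_sub_one_div hz h1).hasSum.sub
    (summable_one_div_sub_one_div hw h1).hasSum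
  have hDD : digamma z - digamma w = D z - D w := by linear_combination e1 - e2
  rw [hDD]
  simpa only [sub_sub_sub_cancel_left] using hs

/-- With `ζ = 1/(w+n)`, the difference of logarithms is `Re log(1 + ζ)`, which is `Re ζ` up to `|ζ|²
/ (2(1-|ζ|))`. The hypotheses give `|w+n|² ≥ 17/16`, hence `|ζ| ≤ 33/34`, and `|ζ|² ≤ 4/(1+n)²`; the
constant is `4 · 34 / 2`. -/
theorem abs_re_one_div_sub_log_le {w : ℂ} (hre : 1 / 4 ≤ w.re) (him : 1 ≤ w.im) (n : ℕ) :
    |(1 / (w + n)).re - (Real.log ‖w + n + 1‖ - Real.log ‖w + n‖)|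
      ≤ 68 * (1 / (1 + (n : ℝ)) ^ 2) := by
  have hn : (0 : ℝ) ≤ n := Nat.cast_nonneg n
  have hsq : 1 + (n + 1 / 4) ^ 2 ≤ ‖w + n‖ ^ 2 := by
    rw [← normSq_eq_norm_sq, normSq_apply]
    simp only [add_re, natCast_re, add_im, natCast_im, add_zero]
    nlinarith
  have hpos : 0 < ‖w + n‖ := by
    by_contra h
    have : ‖w + n‖ = 0 := le_antisymm (not_lt.1 h) (norm_nonneg _)
    rw [this] at hsq
    nlinarith
  have hne : w + n ≠ 0 := norm_pos_iff.1 hpos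
  set ζ := 1 / (w + n) with hζ
  have hζn : ‖ζ‖ = 1 / ‖w + n‖ := by rw [hζ, norm_div, norm_one]
  have hge : 34 / 33 ≤ ‖w + n‖ := by
    by_contra! h
    nlinarith
  have hζle : ‖ζ‖ ≤ 33 / 34 := by
    rw [hζn, div_le_iff₀ hpos]
    linarith
  have h1 := Complex.norm_log_one_add_sub_self_le (z := ζ) (by linarith)
  have h2 : (Complex.log (1 + ζ)).re = Real.log ‖w + n + 1‖ - Real.log ‖w + n‖ := by
    have hne' : w + n + 1 ≠ 0 := by
      intro h
      have := congrArg im h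
      simp at this
      linarith
    rw [Complex.log_re, ← Real.log_div (norm_ne_zero_iff.2 hne') hpos.ne', ← norm_div]
    congr 2
    rw [hζ]
    field_simp
  rw [← h2, ← sub_re]
  refine (abs_re_le_norm _).trans ?_
  rw [norm_sub_rev]
  refine h1.trans ?_
  have h3 : (1 - ‖ζ‖)⁻¹ ≤ 34 := by
    rw [inv_le_comm₀ (by linarith) (by norm_num)]
    linarith
  have h4 : ‖ζ‖ ^ 2 ≤ 4 * (1 / (1 + (n : ℝ)) ^ 2) := by
    rw [hζn, div_pow, one_pow, mul_one_div, div_le_div_iff₀ (by positivity) (by positivity)]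
    nlinarith
  have h5 : 0 ≤ (1 - ‖ζ‖)⁻¹ := inv_nonneg.2 (by linarith)
  calc ‖ζ‖ ^ 2 * (1 - ‖ζ‖)⁻¹ / 2 ≤ (4 * (1 / (1 + (n : ℝ)) ^ 2)) * 34 / 2 := by gcongr
    _ = _ := by ring

/-- `Re ψ(w) = log |w| + O(1)` on `Re w ≥ 1/4`, `Im w ≥ 1`. -/
theorem exists_abs_re_digamma_sub_log_norm_le :
    ∃ C : ℝ, 0 < C ∧ ∀ w : ℂ, 1 / 4 ≤ w.re → 1 ≤ w.im →
      |(digamma w).re - Real.log ‖w‖| ≤ C := by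
  set K : ℝ := ∑' n : ℕ, 68 * (1 / (1 + (n : ℝ)) ^ 2) with hK
  have hKs : Summable fun n : ℕ ↦ 68 * (1 / (1 + (n : ℝ)) ^ 2) :=
    (summable_one_div_add_natCast_sq one_pos).mul_left 68
  have hK0 : 0 ≤ K := tsum_nonneg fun n ↦ by positivity
  refine ⟨|(digamma 1).re| + (1 + K), by positivity, fun w hre him ↦ ?_⟩
  have hs := (Complex.hasSum_digamma_sub_digamma (z := w) (w := 1) (by linarith)
    (by simp)).tendsto_sum_nat
  have hs' := ((continuous_re.tendsto _).comp hs).sub_const (Real.log ‖w‖)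
  have hbound : |(digamma w - digamma 1).re - Real.log ‖w‖| ≤ 1 + K := by
    refine le_of_tendsto hs'.abs ?_
    filter_upwards [eventually_ge_atTop (⌈‖w‖⌉₊ + 1)] with N hN
    have hNw : ‖w‖ ≤ N := (Nat.le_ceil _).trans (by exact_mod_cast (by omega : ⌈‖w‖⌉₊ ≤ N))
    have hN1 : (1 : ℝ) ≤ N := by exact_mod_cast (by omega : 1 ≤ N)
    set e : ℕ → ℝ := fun n ↦
      (1 / (w + n)).re - (Real.log ‖w + n + 1‖ - Real.log ‖w + n‖) with he
    have htel : ∑ n ∈ Finset.range N, (Real.log ‖w + n + 1‖ - Real.log ‖w + n‖)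
        = Real.log ‖w + N‖ - Real.log ‖w‖ := by
      have := Finset.sum_range_sub (fun n : ℕ ↦ Real.log ‖w + n‖) N
      simp only [Nat.cast_zero, add_zero, Nat.cast_succ, ← add_assoc] at this
      exact this
    -- The logarithms telescope. What is left is `log ‖w‖`, the summable error, and `H_N - log
    -- ‖w+N‖`, which is bounded because `N ≤ ‖w+N‖ ≤ 2N`.
    have hsplit : (∑ n ∈ Finset.range N, (1 / (1 + (n : ℂ)) - 1 / (w + n))).re
        = harmonic N - (Real.log ‖w + N‖ - Real.log ‖w‖) - ∑ n ∈ Finset.range N, e n := by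
      have h1 : (∑ n ∈ Finset.range N, 1 / (1 + (n : ℂ))).re = (harmonic N : ℝ) := by
        rw [harmonic]
        push_cast
        rw [← ofReal_re (∑ n ∈ Finset.range N, ((n : ℝ) + 1)⁻¹)]
        push_cast
        congr 1
        refine Finset.sum_congr rfl fun n _ ↦ ?_
        rw [one_div, add_comm]
      rw [Finset.sum_sub_distrib, sub_re, h1, re_sum, ← htel, sub_sub, ← Finset.sum_add_distrib]
      congr 1
      refine Finset.sum_congr rfl fun n _ ↦ ?_
      simp only [he]
      ring
    have herr : |∑ n ∈ Finset.range N, e n| ≤ K :=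
      (Finset.abs_sum_le_sum_abs _ _).trans ((Finset.sum_le_sum fun n _ ↦
        abs_re_one_div_sub_log_le hre him n).trans (hKs.sum_le_tsum _ fun n _ ↦ by positivity))
    have hu := harmonic_le_one_add_log N
    have hl := log_add_one_le_harmonic N
    have hnl : (N : ℝ) ≤ ‖w + N‖ := by
      have := norm_add_natCast_ge (δ := 0) (z := w) (by linarith) N
      linarith
    have hnu : ‖w + N‖ ≤ 2 * N := by
      refine (norm_add_le _ _).trans ?_
      rw [Complex.norm_natCast]
      linarith
    have hl1 : Real.log N ≤ Real.log ‖w + N‖ := Real.log_le_log (by linarith) hnl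
    have hl2 : Real.log ‖w + N‖ ≤ 1 + Real.log (N + 1) := by
      have h1 : Real.log ‖w + N‖ ≤ Real.log (Real.exp 1 * (N + 1)) := by
        refine Real.log_le_log (by linarith) (hnu.trans ?_)
        have := Real.add_one_le_exp 1
        nlinarith
      rwa [Real.log_mul (Real.exp_pos 1).ne' (by positivity), Real.log_exp] at h1
    rw [Function.comp_apply, hsplit]
    rw [abs_le] at herr ⊢
    push_cast at hl
    constructor <;> linarith [herr.1, herr.2]
  rw [sub_re] at hbound
  have h1 := neg_abs_le (digamma 1).re
  have h2 := le_abs_self (digamma 1).re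
  rw [abs_le] at hbound ⊢
  constructor <;> linarith [hbound.1, hbound.2]

end

/-! ### The completed L-function: symmetry, zeros and growth -/

section

open Complex Metric Filter Topology MeasureTheory
open scoped ComplexConjugate

/-- `Λ₀` is a Mellin transform convergent for every `s`, and on the strip `|t^(s-1)| ≤ t^(a-1) +
t^(b-1)`. -/
theorem WeakFEPair.exists_norm_Λ₀_le (P : WeakFEPair ℂ) (a b : ℝ) :
    ∃ C : ℝ, ∀ s : ℂ, a ≤ s.re → s.re ≤ b → ‖P.Λ₀ s‖ ≤ C := by
  have hconv : ∀ r : ℝ, IntegrableOn (fun t : ℝ ↦ t ^ (r - 1) * ‖P.f_modif t‖) (Set.Ioi 0) := by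
    intro r
    have h : MellinConvergent P.f_modif r := (P.isStrongFEPair_toStrongFEPair.hasMellin r).1
    refine (IntegrableOn.congr_fun (Integrable.norm h) (fun t (ht : 0 < t) ↦ ?_) measurableSet_Ioi)
    simp only [norm_smul]
    rw [norm_cpow_eq_rpow_re_of_pos ht]
    simp
  refine ⟨∫ t in Set.Ioi (0 : ℝ), (t ^ (a - 1) * ‖P.f_modif t‖ + t ^ (b - 1) * ‖P.f_modif t‖),
    fun s ha hb ↦ ?_⟩
  refine norm_integral_le_of_norm_le ((hconv a).add (hconv b)) ?_
  refine (ae_restrict_iff' measurableSet_Ioi).2 (ae_of_all _ fun t (ht : 0 < t) ↦ ?_)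
  rw [norm_smul, norm_cpow_eq_rpow_re_of_pos ht, ← add_mul, sub_re, one_re]
  gcongr
  rcases le_total t 1 with h | h
  · exact (Real.rpow_le_rpow_of_exponent_ge ht h (by linarith)).trans
      (le_add_of_nonneg_right (by positivity))
  · exact (Real.rpow_le_rpow_of_exponent_le h (by linarith)).trans
      (le_add_of_nonneg_left (by positivity))

theorem Complex.norm_Gamma_le_Gamma_re {s : ℂ} (hs : 0 < s.re) :
    ‖Complex.Gamma s‖ ≤ Real.Gamma s.re := by
  rw [Complex.Gamma_eq_integral hs, Real.Gamma_eq_integral hs, GammaIntegral]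
  refine norm_integral_le_of_norm_le (Real.GammaIntegral_convergent hs) ?_
  refine (ae_restrict_iff' measurableSet_Ioi).2 (ae_of_all _ fun t (ht : 0 < t) ↦ ?_)
  rw [norm_mul, norm_cpow_eq_rpow_re_of_pos ht, Complex.norm_real, Real.norm_eq_abs,
    abs_of_pos (Real.exp_pos _), sub_re, one_re]

theorem Real.Gamma_le_factorial {x : ℝ} (hx : 1 ≤ x) {n : ℕ} (hn : x ≤ n) :
    Real.Gamma x ≤ n.factorial := by
  have h0 : 0 < Real.Gamma x := Real.Gamma_pos_of_pos (by linarith)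
  calc Real.Gamma x ≤ x * Real.Gamma x := le_mul_of_one_le_left h0.le hx
    _ = Real.Gamma (x + 1) := (Real.Gamma_add_one (by linarith)).symm
    _ ≤ Real.Gamma (n + 1) := Real.Gamma_strictMonoOn_Ici.monotoneOn
        (Set.mem_Ici.2 (by linarith)) (Set.mem_Ici.2 (by linarith)) (by linarith)
    _ = n.factorial := Real.Gamma_nat_eq_factorial n

theorem Complex.norm_Gammaℝ_le_factorial {s : ℂ} (hs : 2 ≤ s.re) {n : ℕ} (hn : s.re ≤ n) :
    ‖Gammaℝ s‖ ≤ n.factorial := by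
  have h2 : (s / 2).re = s.re / 2 := by simp
  rw [Gammaℝ_def, norm_mul]
  refine (mul_le_of_le_one_left (norm_nonneg _) ?_).trans
    ((norm_Gamma_le_Gamma_re (by rw [h2]; linarith)).trans
      (Real.Gamma_le_factorial (by rw [h2]; linarith) (by rw [h2]; linarith)))
  rw [norm_cpow_eq_rpow_re_of_pos Real.pi_pos]
  refine Real.rpow_le_one_of_one_le_of_nonpos (by linarith [Real.pi_gt_three]) ?_
  rw [neg_div, neg_re, h2]
  linarith

theorem Complex.Gammaℝ_conj (s : ℂ) : Gammaℝ (conj s) = conj (Gammaℝ s) := by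
  have h : conj s / 2 = conj (s / 2) := by rw [map_div₀, conj_ofNat]
  have harg : ((Real.pi : ℝ) : ℂ).arg ≠ Real.pi := by
    rw [arg_ofReal_of_nonneg Real.pi_pos.le]; exact Real.pi_pos.ne
  rw [Gammaℝ_def, Gammaℝ_def, map_mul, h, Gamma_conj, neg_div, h, ← map_neg, cpow_conj _ _ harg,
    conj_ofReal, neg_div]

namespace DirichletCharacter

theorem exists_gammaFactor_eq {q : ℕ} (χ : DirichletCharacter ℂ q) :
    ∃ κ : ℕ, κ ≤ 1 ∧ ∀ s, gammaFactor χ s = Gammaℝ (s + κ) := by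
  rcases χ.even_or_odd with h | h
  · exact ⟨0, by simp, fun s ↦ by rw [h.gammaFactor_def]; simp⟩
  · exact ⟨1, le_rfl, fun s ↦ by rw [h.gammaFactor_def]; simp⟩

theorem gammaFactor_inv {q : ℕ} (χ : DirichletCharacter ℂ q) : gammaFactor χ⁻¹ = gammaFactor χ := by
  have : χ⁻¹.Even ↔ χ.Even := by
    rw [DirichletCharacter.Even, DirichletCharacter.Even, MulChar.inv_apply_eq_inv', inv_eq_one]
  ext s
  rcases χ.even_or_odd with h | h
  · rw [(this.2 h).gammaFactor_def, h.gammaFactor_def]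
  · rw [(χ⁻¹.even_or_odd.resolve_left fun h' ↦ h.not_even _ (this.1 h')).gammaFactor_def,
      h.gammaFactor_def]

theorem gammaFactor_ne_zero_of_re_pos {q : ℕ} (χ : DirichletCharacter ℂ q) {s : ℂ} (hs : 0 < s.re) :
    gammaFactor χ s ≠ 0 := by
  obtain ⟨κ, -, h⟩ := exists_gammaFactor_eq χ
  rw [h]
  refine Gammaℝ_ne_zero_of_re_pos ?_
  rw [add_re, natCast_re]
  positivity

theorem gammaFactor_conj {q : ℕ} (χ : DirichletCharacter ℂ q) (s : ℂ) :
    gammaFactor χ (conj s) = conj (gammaFactor χ s) := by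
  obtain ⟨κ, -, h⟩ := exists_gammaFactor_eq χ
  rw [h, h, ← Gammaℝ_conj, map_add, conj_natCast]

variable {q : ℕ} [NeZero q] {χ : DirichletCharacter ℂ q}

theorem completedLFunction_eq_mul_gammaFactor (χ : DirichletCharacter ℂ q) {s : ℂ}
    (hs : 0 < s.re) : completedLFunction χ s = LFunction χ s * gammaFactor χ s := by
  rw [LFunction_eq_completed_div_gammaFactor χ s (Or.inl fun h ↦ by simp [h] at hs),
    div_mul_cancel₀ _ (gammaFactor_ne_zero_of_re_pos χ hs)]

theorem LFunction_inv_eq_conj (χ : DirichletCharacter ℂ q) {s : ℂ} (hs : 1 < s.re) :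
    LFunction χ⁻¹ s = conj (LFunction χ (conj s)) := by
  rw [LFunction_eq_LSeries _ hs, LFunction_eq_LSeries _ (by rwa [conj_re]), LSeries, LSeries,
    conj_tsum]
  congr 1
  ext n
  rcases eq_or_ne n 0 with rfl | hn
  · simp
  rw [LSeries.term_of_ne_zero hn, LSeries.term_of_ne_zero hn, map_div₀, ← MulChar.star_apply',
    cpow_conj _ _ (by rw [natCast_arg]; exact Real.pi_pos.ne), conj_conj, conj_natCast]
  rfl

theorem completedLFunction_inv_eq_conj (hχ : χ ≠ 1) (s : ℂ) :
    completedLFunction χ⁻¹ s = conj (completedLFunction χ (conj s)) := by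
  have h1 : Differentiable ℂ (completedLFunction χ⁻¹) :=
    differentiable_completedLFunction (inv_ne_one.2 hχ)
  have h2 : Differentiable ℂ (conj ∘ completedLFunction χ ∘ conj) := fun z ↦
    differentiableAt_conj_conj_iff.2 (differentiable_completedLFunction hχ _)
  have h3 : completedLFunction χ⁻¹ =ᶠ[𝓝 2] (conj ∘ completedLFunction χ ∘ conj) := by
    filter_upwards [(isOpen_lt continuous_const continuous_re).mem_nhds
      (show (2 : ℂ) ∈ {z : ℂ | 1 < z.re} by simp)] with z (hz : 1 < z.re)
    simp only [Function.comp_apply]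
    rw [completedLFunction_eq_mul_gammaFactor _ (by linarith), completedLFunction_eq_mul_gammaFactor
      _ (by rw [conj_re]; linarith), LFunction_inv_eq_conj χ hz, gammaFactor_inv, map_mul,
      gammaFactor_conj, conj_conj]
  have h4 := AnalyticOnNhd.eq_of_eventuallyEq (fun z _ ↦ h1.analyticAt z)
    (fun z _ ↦ h2.analyticAt z) h3
  exact congrFun h4 s

/-- On the critical line, `Re Λ'/Λ(s, χ) = -(log q) / 2`. -/
theorem IsPrimitive.re_logDeriv_completedLFunction (hχ : χ.IsPrimitive) (hχ1 : χ ≠ 1) {c : ℂ}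
    (hc : c.re = 1 / 2) (hne : completedLFunction χ c ≠ 0) :
    (logDeriv (completedLFunction χ) c).re = -(Real.log q / 2) := by
  set f := completedLFunction χ with hf
  have hfd : Differentiable ℂ f := differentiable_completedLFunction hχ1
  have hq : (q : ℂ) ≠ 0 := Nat.cast_ne_zero.2 (NeZero.ne q)
  -- Conjugation turns the functional equation into a relation of `f` with itself. It is
  -- differentiated at `conj c`, because `1 - conj c = c` on the critical line.
  have hfe : (fun s ↦ f (1 - s)) =
      fun s ↦ (q : ℂ) ^ (s - 1 / 2) * rootNumber χ * (conj ∘ f ∘ conj) s := by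
    ext s
    rw [hf, hχ.completedLFunction_one_sub, completedLFunction_inv_eq_conj hχ1]
    rfl
  have hcc : 1 - conj c = c := by
    apply Complex.ext
    · rw [sub_re, conj_re, one_re, hc]; norm_num
    · simp
  have hL : HasDerivAt (fun s ↦ f (1 - s)) (-deriv f c) (conj c) := by
    have h1 : HasDerivAt (fun s : ℂ ↦ 1 - s) (-1) (conj c) := (hasDerivAt_id _).const_sub 1
    have h2 : HasDerivAt f (deriv f c) (1 - conj c) := by rw [hcc]; exact (hfd c).hasDerivAt
    exact (h2.comp (conj c) h1).congr_deriv (by ring)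
  have hR : HasDerivAt (fun s ↦ (q : ℂ) ^ (s - 1 / 2) * rootNumber χ * (conj ∘ f ∘ conj) s)
      ((q : ℂ) ^ (conj c - 1 / 2) * Complex.log q * 1 * rootNumber χ * (conj ∘ f ∘ conj) (conj c)
        + (q : ℂ) ^ (conj c - 1 / 2) * rootNumber χ * conj (deriv f c)) (conj c) := by
    have h1 : HasDerivAt (fun s : ℂ ↦ (q : ℂ) ^ (s - 1 / 2))
        ((q : ℂ) ^ (conj c - 1 / 2) * Complex.log q * 1) (conj c) :=
      ((hasDerivAt_id (conj c)).sub_const (1 / 2)).const_cpow (Or.inl hq)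
    exact (h1.mul_const (rootNumber χ)).fun_mul (hfd c).hasDerivAt.conj_conj
  have hval := congrFun hfe (conj c)
  rw [hfe] at hL
  have hder := hL.unique hR
  simp only [hcc, Function.comp_apply, conj_conj] at hval hder
  set A := (q : ℂ) ^ (conj c - 1 / 2) * rootNumber χ with hA
  have hA' : -deriv f c = Complex.log q * f c + A * conj (deriv f c) := by
    rw [hder]; linear_combination -(Complex.log q) * hval
  have hcf : conj (f c) ≠ 0 := by simpa using hne
  have hkey : -logDeriv f c = Complex.log q + conj (logDeriv f c) := by
    rw [logDeriv_apply, map_div₀]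
    have hA0 : A ≠ 0 := fun h ↦ hne (by rw [hval, h, zero_mul])
    have : conj (deriv f c) / conj (f c) = A * conj (deriv f c) / f c := by
      rw [div_eq_div_iff hcf hne]
      linear_combination conj (deriv f c) * hval
    rw [this]
    field_simp
    linear_combination hA'
  have hre := congrArg re hkey
  rw [neg_re, add_re, conj_re, ← natCast_log, ofReal_re] at hre
  linarith

theorem completedLFunction_ne_zero_of_one_le_re (hχ : χ ≠ 1) {s : ℂ} (hs : 1 ≤ s.re) :
    completedLFunction χ s ≠ 0 := by
  rw [completedLFunction_eq_mul_gammaFactor _ (by linarith)]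
  exact mul_ne_zero (LFunction_ne_zero_of_one_le_re χ (.inl hχ) hs)
    (gammaFactor_ne_zero_of_re_pos χ (by linarith))

theorem IsPrimitive.re_eq_half_of_completedLFunction_eq_zero (hχ : χ.IsPrimitive) (hχ1 : χ ≠ 1)
    (hGRH : GRHFor χ) {s : ℂ} (hs : completedLFunction χ s = 0) : s.re = 1 / 2 := by
  have h1 : s.re < 1 := by
    by_contra! h
    exact completedLFunction_ne_zero_of_one_le_re hχ1 h hs
  have h0 : 0 < s.re := by
    -- A zero with `re s ≤ 0` reflects to `re (1 - s) ≥ 1`, where `Λ(·, χ⁻¹)` does not vanish. The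
    -- root number would then be zero, and the functional equation would give `Λ(2, χ) = 0`.
    by_contra! h
    have hfe := hχ.completedLFunction_one_sub s
    have hfe' := hχ.completedLFunction_one_sub (1 - s)
    rw [sub_sub_cancel, hs] at hfe'
    have hne := completedLFunction_ne_zero_of_one_le_re (inv_ne_one.2 hχ1)
      (s := 1 - s) (by rw [sub_re, one_re]; linarith)
    have hq : ((q : ℂ) ^ (1 - s - 1 / 2)) ≠ 0 := by
      rw [Ne, cpow_eq_zero_iff]
      simp [NeZero.ne q]
    have hroot : rootNumber χ = 0 := by
      rcases mul_eq_zero.1 hfe'.symm with h | h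
      · exact (mul_eq_zero.1 h).resolve_left hq
      · exact absurd h hne
    have h2 := hχ.completedLFunction_one_sub (-1)
    rw [hroot, mul_zero, zero_mul] at h2
    exact completedLFunction_ne_zero_of_one_le_re hχ1 (by norm_num) h2
  refine hGRH s ?_ h0 h1
  have := completedLFunction_eq_mul_gammaFactor χ h0
  rw [hs] at this
  exact (mul_eq_zero.1 this.symm).resolve_right (gammaFactor_ne_zero_of_re_pos χ h0)

theorem exists_norm_completedLFunction_le_of_strip (hχ : χ ≠ 1) :
    ∃ C : ℝ, ∀ s : ℂ, -1 ≤ s.re → s.re ≤ 2 → ‖completedLFunction χ s‖ ≤ C := by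
  have hq1 : q ≠ 1 := hχ ∘ level_one' _
  choose Ce hCe using fun j : ZMod q ↦
    (HurwitzZeta.hurwitzEvenFEPair (ZMod.toAddCircle j)).exists_norm_Λ₀_le (-1) 2
  choose Co hCo using fun j : ZMod q ↦
    (HurwitzZeta.hurwitzOddFEPair (ZMod.toAddCircle j)).exists_norm_Λ₀_le (-1) 2
  refine ⟨q * ∑ j : ZMod q, ‖χ j‖ * (Ce j / 2) + q * ∑ j : ZMod q, ‖χ j‖ * (Co j / 2),
    fun s h1 h2 ↦ ?_⟩
  have hq : (1 : ℝ) ≤ q := by exact_mod_cast Nat.one_le_iff_ne_zero.2 (NeZero.ne q)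
  have hqs : ‖(q : ℂ) ^ (-s)‖ ≤ q := by
    rw [norm_natCast_cpow_of_pos (Nat.pos_of_ne_zero (NeZero.ne q)), neg_re]
    exact (Real.rpow_le_rpow_of_exponent_le hq (by linarith)).trans_eq (Real.rpow_one _)
  -- The polar terms have coefficients `χ 0` and `∑ χ j`, both zero for `χ ≠ 1`; only the Mellin
  -- transforms bounded on strips remain.
  rw [completedLFunction, ZMod.completedLFunction_eq, χ.map_zero' hq1,
    χ.sum_eq_zero_of_ne_one hχ, ZMod.completedLFunction₀]
  simp only [mul_zero, zero_div, sub_zero]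
  refine (norm_add_le _ _).trans (add_le_add ?_ ?_)
  · rw [norm_mul]
    gcongr
    refine (norm_sum_le _ _).trans (Finset.sum_le_sum fun j _ ↦ ?_)
    rw [norm_mul, HurwitzZeta.completedHurwitzZetaEven₀, norm_div, Complex.norm_ofNat]
    gcongr
    exact hCe j _ (by simp; linarith) (by simp; linarith)
  · rw [norm_mul]
    gcongr
    refine (norm_sum_le _ _).trans (Finset.sum_le_sum fun j _ ↦ ?_)
    rw [norm_mul, HurwitzZeta.completedHurwitzZetaOdd, norm_div, Complex.norm_ofNat]
    gcongr
    have : (HurwitzZeta.hurwitzOddFEPair (ZMod.toAddCircle j)).Λ ((s + 1) / 2)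
        = (HurwitzZeta.hurwitzOddFEPair (ZMod.toAddCircle j)).Λ₀ ((s + 1) / 2) := by
      simp [WeakFEPair.Λ, HurwitzZeta.hurwitzOddFEPair]
    rw [this]
    exact hCo j _ (by simp; linarith) (by simp; linarith)

theorem exists_norm_LFunction_le_of_two_le_re (χ : DirichletCharacter ℂ q) :
    ∃ C : ℝ, ∀ s : ℂ, 2 ≤ s.re → ‖LFunction χ s‖ ≤ C := by
  have hsum := Real.summable_one_div_nat_pow.2 (show 1 < 2 by norm_num)
  refine ⟨∑' n : ℕ, 1 / (n : ℝ) ^ 2, fun s hs ↦ ?_⟩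
  rw [LFunction_eq_LSeries χ (by linarith), LSeries]
  refine tsum_of_norm_bounded hsum.hasSum fun n ↦ ?_
  rcases eq_or_ne n 0 with rfl | hn
  · simp
  have hn1 : (1 : ℝ) ≤ n := by exact_mod_cast Nat.one_le_iff_ne_zero.2 hn
  rw [LSeries.term_of_ne_zero hn, norm_div, norm_natCast_cpow_of_pos (Nat.pos_of_ne_zero hn)]
  gcongr
  · exact χ.norm_le_one _
  · calc (n : ℝ) ^ 2 = (n : ℝ) ^ (2 : ℝ) := by norm_cast
      _ ≤ _ := Real.rpow_le_rpow_of_exponent_le hn1 hs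

theorem exists_norm_completedLFunction_le_of_two_le_re (χ : DirichletCharacter ℂ q) :
    ∃ C : ℝ, 0 ≤ C ∧ ∀ (s : ℂ) (n : ℕ), 2 ≤ s.re → s.re + 1 ≤ n →
      ‖completedLFunction χ s‖ ≤ C * n.factorial := by
  obtain ⟨C, hC⟩ := exists_norm_LFunction_le_of_two_le_re χ
  have hC0 : 0 ≤ C := (norm_nonneg _).trans (hC 2 (by simp))
  refine ⟨C, hC0, fun s n hs hn ↦ ?_⟩
  obtain ⟨κ, hκ, hγ⟩ := exists_gammaFactor_eq χ
  have hκ' : (κ : ℝ) ≤ 1 := by exact_mod_cast hκ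
  have hκ0 : (0 : ℝ) ≤ κ := Nat.cast_nonneg κ
  rw [completedLFunction_eq_mul_gammaFactor χ (by linarith), norm_mul, hγ]
  gcongr
  · exact hC s hs
  · exact norm_Gammaℝ_le_factorial (by rw [add_re, natCast_re]; linarith)
      (by rw [add_re, natCast_re]; linarith)

/-- The strip `-1 ≤ re s ≤ 2` is bounded, the right half-plane is governed by the Gamma factor, and
the functional equation reflects the left one into it. The margin `2` in `‖s‖ + 2 ≤ n` is there
because `re (1 - s) + 1 ≤ ‖s‖ + 2`. -/
theorem IsPrimitive.exists_norm_completedLFunction_le (hχ : χ.IsPrimitive) (hχ1 : χ ≠ 1) :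
    ∃ K : ℝ, 0 < K ∧ ∀ (s : ℂ) (n : ℕ), ‖s‖ + 2 ≤ n →
      ‖completedLFunction χ s‖ ≤ K * (q * n) ^ n := by
  obtain ⟨C₁, h₁⟩ := exists_norm_completedLFunction_le_of_strip hχ1
  obtain ⟨C₂, h₂0, h₂⟩ := exists_norm_completedLFunction_le_of_two_le_re χ
  obtain ⟨C₃, h₃0, h₃⟩ := exists_norm_completedLFunction_le_of_two_le_re χ⁻¹
  have hq : (1 : ℝ) ≤ q := by exact_mod_cast Nat.one_le_iff_ne_zero.2 (NeZero.ne q)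
  set K := |C₁| + C₂ + ‖rootNumber χ‖ * C₃ + 1 with hK
  have hR0 : 0 ≤ ‖rootNumber χ‖ * C₃ := by positivity
  have hK0 : 0 < K := by positivity
  refine ⟨K, hK0, fun s n hn ↦ ?_⟩
  have hre := abs_le.1 (abs_re_le_norm s)
  have hn2 : (2 : ℝ) ≤ n := by linarith [norm_nonneg s]
  have hfac : (n.factorial : ℝ) ≤ (n : ℝ) ^ n := by exact_mod_cast n.factorial_le_pow
  have hqn : (1 : ℝ) ≤ (q : ℝ) ^ n := one_le_pow₀ hq
  have hnn : (1 : ℝ) ≤ (n : ℝ) ^ n := one_le_pow₀ (by linarith)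
  rw [mul_pow]
  rcases lt_or_ge s.re (-1) with h | h
  · have hfe := hχ.completedLFunction_one_sub (1 - s)
    rw [sub_sub_cancel] at hfe
    rw [hfe, norm_mul, norm_mul, norm_natCast_cpow_of_pos (Nat.pos_of_ne_zero (NeZero.ne q))]
    have e1 : (q : ℝ) ^ (1 - s - 1 / 2).re ≤ (q : ℝ) ^ n := by
      rw [← Real.rpow_natCast]
      refine Real.rpow_le_rpow_of_exponent_le hq ?_
      simp
      linarith
    have e2 := h₃ (1 - s) n (by rw [sub_re, one_re]; linarith) (by rw [sub_re, one_re]; linarith)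
    calc (q : ℝ) ^ (1 - s - 1 / 2).re * ‖rootNumber χ‖ * ‖completedLFunction χ⁻¹ (1 - s)‖
        ≤ (q : ℝ) ^ n * ‖rootNumber χ‖ * (C₃ * (n : ℝ) ^ n) := by
          gcongr
          exact e2.trans (by gcongr)
      _ = ‖rootNumber χ‖ * C₃ * ((q : ℝ) ^ n * (n : ℝ) ^ n) := by ring
      _ ≤ K * ((q : ℝ) ^ n * (n : ℝ) ^ n) := by
          gcongr
          rw [hK]; linarith [abs_nonneg C₁]
  rcases le_or_gt s.re 2 with h' | h'
  · calc ‖completedLFunction χ s‖ ≤ C₁ := h₁ s h h'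
      _ ≤ K := by rw [hK]; linarith [le_abs_self C₁]
      _ ≤ K * ((q : ℝ) ^ n * (n : ℝ) ^ n) :=
          le_mul_of_one_le_right hK0.le (one_le_mul_of_one_le_of_one_le hqn hnn)
  · calc ‖completedLFunction χ s‖ ≤ C₂ * n.factorial := h₂ s n h'.le (by linarith)
      _ ≤ C₂ * (1 * (n : ℝ) ^ n) := by rw [one_mul]; gcongr
      _ ≤ C₂ * ((q : ℝ) ^ n * (n : ℝ) ^ n) := by gcongr
      _ ≤ K * ((q : ℝ) ^ n * (n : ℝ) ^ n) := by
          gcongr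
          rw [hK]; linarith [abs_nonneg C₁]

theorem IsPrimitive.norm_completedLFunction_add_le_exp (hχ : χ.IsPrimitive) (hχ1 : χ ≠ 1) (c : ℂ)
    {ε : ℝ} (hε : 0 < ε) :
    ∀ᶠ R : ℝ in atTop, ∀ z, ‖z‖ ≤ R → ‖completedLFunction χ (c + z)‖ ≤ Real.exp (ε * R ^ 2) := by
  obtain ⟨K, hK, hle⟩ := hχ.exists_norm_completedLFunction_le hχ1
  have hq : (1 : ℝ) ≤ q := by exact_mod_cast Nat.one_le_iff_ne_zero.2 (NeZero.ne q)
  have hlog := (Real.isLittleO_log_id_atTop.bound (show 0 < ε / (8 * q) by positivity))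
  have h2R : Tendsto (fun R : ℝ ↦ q * (2 * R)) atTop atTop :=
    (tendsto_id.const_mul_atTop (by norm_num)).const_mul_atTop (by linarith)
  have hsq : Tendsto (fun R : ℝ ↦ R ^ 2) atTop atTop := tendsto_pow_atTop (by norm_num)
  filter_upwards [h2R.eventually hlog, eventually_ge_atTop (‖c‖ + 3), eventually_ge_atTop 1,
    hsq.eventually_ge_atTop (2 * Real.log K / ε)] with R hR hRc hR1 hRK z hz
  set n := ⌈‖c‖ + R + 2⌉₊ with hn
  have hn1 : ‖c‖ + R + 2 ≤ n := Nat.le_ceil _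
  have hn2 : (n : ℝ) ≤ 2 * R := by
    have := Nat.ceil_lt_add_one (show 0 ≤ ‖c‖ + R + 2 by positivity)
    linarith
  have hnpos : (0 : ℝ) < n := by linarith [norm_nonneg c]
  refine (hle (c + z) n (by linarith [norm_add_le c z])).trans ?_
  rw [← Real.log_le_iff_le_exp (by positivity), Real.log_mul hK.ne' (by positivity), Real.log_pow]
  -- From `log y ≤ ε y / (8q)` at `y = 2qR`. With `n ≤ 2R`, `n log(qn)` uses half of `ε R²` and
  -- leaves the other half for `log K`.
  have h1 : Real.log (q * n) ≤ ε / 4 * R := by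
    have h3 : Real.log (q * n) ≤ Real.log (q * (2 * R)) :=
      Real.log_le_log (by positivity) (by gcongr)
    have h4 := (le_abs_self _).trans hR
    rw [id, Real.norm_eq_abs, abs_of_pos (by positivity)] at h4
    refine h3.trans (h4.trans (le_of_eq ?_))
    field_simp
    norm_num
  have h2 : (n : ℝ) * Real.log (q * n) ≤ 2 * R * (ε / 4 * R) :=
    mul_le_mul hn2 h1 (Real.log_nonneg (by nlinarith [norm_nonneg c])) (by positivity)
  rw [div_le_iff₀ hε] at hRK
  nlinarith

end DirichletCharacter

end

/-! ### Sums over zeros for `Λ'/Λ` -/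

section

open Complex Metric Filter Topology MeasureTheory
open scoped ComplexConjugate

theorem one_div_re_eq (s : ℂ) (γ : ℝ) :
    (1 / (s - (1 / 2 + γ * I))).re = (s.re - 1 / 2) / ‖s - (1 / 2 + γ * I)‖ ^ 2 := by
  rw [one_div, inv_re, normSq_eq_norm_sq]
  congr 1
  simp

namespace DirichletCharacter

variable {q : ℕ} [NeZero q] {χ : DirichletCharacter ℂ q}

theorem exists_completedLFunction_ne_zero_on_line (hχ : χ ≠ 1) :
    ∃ δ : ℝ, completedLFunction χ (1 / 2 + δ * I) ≠ 0 := by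
  by_contra! h
  have hd : AnalyticOnNhd ℂ (completedLFunction χ) Set.univ := fun z _ ↦
    (differentiable_completedLFunction hχ).analyticAt z
  have hseq : Tendsto (fun n : ℕ ↦ (1 / 2 + ((1 / ((n : ℝ) + 1) : ℝ) : ℂ) * I)) atTop
      (𝓝[≠] (1 / 2)) := by
    refine tendsto_nhdsWithin_iff.2 ⟨?_, Eventually.of_forall fun n ↦ ?_⟩
    · have h1 := (continuous_ofReal.tendsto (0 : ℝ)).comp
        (tendsto_one_div_add_atTop_nhds_zero_nat (𝕜 := ℝ))
      have h2 := (h1.mul_const I).const_add (1 / 2 : ℂ)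
      rwa [ofReal_zero, zero_mul, add_zero] at h2
    · have h0 : (1 / ((n : ℝ) + 1) : ℝ) ≠ 0 := by positivity
      intro h1
      rw [Set.mem_singleton_iff, add_eq_left, mul_eq_zero, ofReal_eq_zero] at h1
      exact h1.elim h0 I_ne_zero
  have hz := hd.eqOn_zero_of_preconnected_of_frequently_eq_zero isPreconnected_univ
    (Set.mem_univ (1 / 2)) (hseq.frequently (Eventually.of_forall fun n ↦ h _).frequently)
    (Set.mem_univ 2)
  exact completedLFunction_ne_zero_of_one_le_re hχ (by norm_num) hz

/-- Under GRH, the partial fraction expansion of `Λ'/Λ(s, χ)` over the zeros `1/2 + iγ`. -/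
theorem IsPrimitive.exists_partialFraction (hχ : χ.IsPrimitive) (hχ1 : χ ≠ 1)
    (hGRH : GRHFor χ) :
    ∃ (ι : Type) (_ : Countable ι) (m : ι → ℝ) (γ : ι → ℝ), (∀ i, 0 ≤ m i) ∧
      (∀ s : ℂ, 1 / 2 < s.re → HasSum (fun i ↦ m i * (1 / (s - (1 / 2 + γ i * I))).re)
        ((logDeriv (completedLFunction χ) s).re + Real.log q / 2)) ∧
      ∀ s s' : ℂ, 1 / 2 < s.re → 1 / 2 < s'.re →
        HasSum (fun i ↦ (m i : ℂ) * (1 / (s - (1 / 2 + γ i * I)) - 1 / (s' - (1 / 2 + γ i * I))))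
          (logDeriv (completedLFunction χ) s - logDeriv (completedLFunction χ) s') := by
  -- The expansion is centred at a point `c` of the critical line which is not a zero: the zeros
  -- become imaginary relative to `c`, and `Re Λ'/Λ(c)` is known from the functional equation.
  obtain ⟨δ, hδ⟩ := exists_completedLFunction_ne_zero_on_line hχ1
  set c : ℂ := 1 / 2 + δ * I with hc
  have hcre : c.re = 1 / 2 := by simp [hc]
  set g : ℂ → ℂ := fun z ↦ completedLFunction χ (c + z) with hg
  have hgd : Differentiable ℂ g :=
    (differentiable_completedLFunction hχ1).comp (differentiable_id.const_add c)
  have hg0 : g 0 ≠ 0 := by simpa [hg] using hδ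
  have hline : ∀ z, g z = 0 → z.re = 0 := fun z hz ↦ by
    have := hχ.re_eq_half_of_completedLFunction_eq_zero hχ1 hGRH hz
    rw [add_re, hcre] at this
    linarith
  have hgrow : ∀ ε > 0, ∀ᶠ R : ℝ in atTop, ∀ z, ‖z‖ ≤ R → ‖g z‖ ≤ Real.exp (ε * R ^ 2) :=
    fun ε hε ↦ hχ.norm_completedLFunction_add_le_exp hχ1 c hε
  have hld : ∀ z, logDeriv g z = logDeriv (completedLFunction χ) (c + z) := fun z ↦ by
    rw [logDeriv_apply, logDeriv_apply, hg, deriv_comp_const_add]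
  set M : ℝ → ℕ := fun γ ↦ analyticOrderNatAt g (γ * I) with hM
  have hM0 : M 0 = 0 := by
    by_contra hne
    exact hg0 (by simpa using apply_eq_zero_of_analyticOrderNatAt_ne_zero hne)
  -- The sum over all real `γ` is restricted to the actual zeros, since integrating the series term
  -- by term later requires a countable index.
  set Z : Set ℝ := {γ | M γ ≠ 0} with hZ
  have hcount : Z.Countable := by
    refine (summable_order_div_sq hgd hg0 hline hgrow).countable_support.mono fun γ hγ ↦ ?_
    have hγ0 : γ ≠ 0 := fun h ↦ hγ (h ▸ hM0)
    have hγ1 : (M γ : ℝ) ≠ 0 := Nat.cast_ne_zero.2 hγ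
    exact div_ne_zero hγ1 (pow_ne_zero 2 hγ0)
  have hsum : ∀ s : ℂ, 1 / 2 < s.re → HasSum
      (fun i : Z ↦ ((M i : ℝ) : ℂ) * (1 / (s - (1 / 2 + ((δ + i : ℝ) : ℂ) * I)) + 1 / (i * I)))
      (logDeriv (completedLFunction χ) s - logDeriv (completedLFunction χ) c) := by
    intro s hs
    have h1 := hasSum_logDeriv_sub_logDeriv hgd hg0 hline hgrow (z := s - c)
      (by rw [sub_re, hcre]; linarith)
    rw [hld, hld, add_sub_cancel, add_zero] at h1
    rw [← hasSum_subtype_iff_of_support_subset (s := Z)] at h1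
    · refine Eq.mp (congrArg (fun f ↦ HasSum f _) (funext fun i ↦ ?_)) h1
      simp only [Function.comp_apply, hM, ofReal_natCast, hc, ofReal_add]
      ring_nf
    · intro γ hγ h0
      refine hγ ?_
      simp only [hM] at h0
      simp [h0]
  refine ⟨Z, hcount.to_subtype, fun i ↦ M i, fun i ↦ δ + i, fun i ↦ by positivity, fun s hs ↦ ?_,
    fun s s' hs hs' ↦ ?_⟩
  -- The compensating terms `1/(iγ)` have real part zero, and the value at `c` supplies `(log q)/2`;
  -- no unknown Hadamard constant appears.
  · have h1 := hasSum_re (hsum s hs)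
    have h2 := hχ.re_logDeriv_completedLFunction hχ1 hcre hδ
    rw [sub_re, h2, sub_neg_eq_add] at h1
    refine Eq.mp (congrArg (fun f ↦ HasSum f _) (funext fun i ↦ ?_)) h1
    rw [re_ofReal_mul, add_re]
    simp
  · have h1 := (hsum s hs).sub (hsum s' hs')
    rw [sub_sub_sub_cancel_right] at h1
    refine Eq.mp (congrArg (fun f ↦ HasSum f _) (funext fun i ↦ ?_)) h1
    ring

theorem logDeriv_gammaFactor_eq {q : ℕ} {χ : DirichletCharacter ℂ q} {κ : ℕ}
    (hκ : ∀ s, gammaFactor χ s = Gammaℝ (s + κ)) {s : ℂ}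
    (hs : 0 < s.re) :
    DifferentiableAt ℂ (gammaFactor χ) s ∧
      logDeriv (gammaFactor χ) s
        = -(Real.log Real.pi / 2 : ℝ) + digamma ((s + κ) / 2) / 2 := by
  have hre : 0 < ((s + κ) / 2).re := by
    have : ((s + κ) / 2).re = (s.re + κ) / 2 := by simp
    rw [this]; positivity
  have hπ : (Real.pi : ℂ) ≠ 0 := ofReal_ne_zero.2 Real.pi_ne_zero
  have hfun : gammaFactor χ = fun s : ℂ ↦
      (Real.pi : ℂ) ^ (-(s + κ) / 2) * Complex.Gamma ((s + κ) / 2) := by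
    ext s; rw [hκ, Gammaℝ_def]
  have h1 : HasDerivAt (fun s : ℂ ↦ (s + κ) / 2) (1 / 2) s :=
    ((hasDerivAt_id s).add_const _).div_const 2
  have h1' : HasDerivAt (fun s : ℂ ↦ -(s + κ) / 2) (-1 / 2) s :=
    ((hasDerivAt_id s).add_const _).neg.div_const 2
  have h2 := h1'.const_cpow (c := (Real.pi : ℂ)) (Or.inl hπ)
  have h3 : HasDerivAt (fun s : ℂ ↦ Complex.Gamma ((s + κ) / 2))
      (deriv Complex.Gamma ((s + κ) / 2) * (1 / 2)) s :=
    (differentiableAt_Gamma _ (ne_neg_natCast_of_re_pos hre)).hasDerivAt.comp s h1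
  have h4 := h2.fun_mul h3
  have hΓ := Gamma_ne_zero_of_re_pos hre
  have hp : (Real.pi : ℂ) ^ (-(s + κ) / 2) ≠ 0 := by
    rw [Ne, cpow_eq_zero_iff]; tauto
  rw [hfun]
  refine ⟨h4.differentiableAt, ?_⟩
  rw [logDeriv_apply, h4.deriv, digamma_def, logDeriv_apply, ofReal_div, ofReal_log Real.pi_pos.le]
  field_simp
  push_cast
  ring

theorem GRHFor.LFunction_ne_zero (hχ1 : χ ≠ 1) (hGRH : GRHFor χ) {s : ℂ} (hs : 1 / 2 < s.re) :
    LFunction χ s ≠ 0 := fun h ↦ by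
  rcases lt_or_ge s.re 1 with h1 | h1
  · linarith [hGRH s h (by linarith) h1]
  · exact LFunction_ne_zero_of_one_le_re χ (.inl hχ1) h1 h

theorem logDeriv_completedLFunction_eq (hχ1 : χ ≠ 1) (hGRH : GRHFor χ) {κ : ℕ}
    (hκ : ∀ s, gammaFactor χ s = Gammaℝ (s + κ)) {s : ℂ} (hs : 1 / 2 < s.re) :
    logDeriv (completedLFunction χ) s = logDeriv (LFunction χ) s
      + (-(Real.log Real.pi / 2 : ℝ) + digamma ((s + κ) / 2) / 2) := by
  have hs0 : 0 < s.re := by linarith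
  obtain ⟨hd, hg⟩ := logDeriv_gammaFactor_eq hκ hs0
  have hev : completedLFunction χ =ᶠ[𝓝 s] fun z ↦ LFunction χ z * gammaFactor χ z := by
    filter_upwards [(isOpen_lt continuous_const continuous_re).mem_nhds hs0] with z hz
    exact completedLFunction_eq_mul_gammaFactor χ hz
  rw [logDeriv_apply, hev.deriv_eq, hev.self_of_nhds, ← logDeriv_apply
    (fun z ↦ LFunction χ z * gammaFactor χ z), logDeriv_mul s (GRHFor.LFunction_ne_zero hχ1 hGRH hs)
    (gammaFactor_ne_zero_of_re_pos χ hs0) (differentiable_LFunction hχ1 s) hd, hg]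

end DirichletCharacter

end

/-! ### The explicit formula -/

section

open Complex Metric Filter Topology MeasureTheory

/-- The weight of `Λ_x`, flat up to `x` and then linear in `log n`, is a difference of two ramps;
each ramp is a sum that `tsum_mul_max_sub_log_eq` evaluates. -/
theorem log_mul_smoothedVonMangoldt {x : ℝ} (hx : 1 < x) {n : ℕ} (hn : n ≠ 0) :
    Real.log x * smoothedVonMangoldt x n = ArithmeticFunction.vonMangoldt n *
      (max (2 * Real.log x - Real.log n) 0 - max (Real.log x - Real.log n) 0) := by
  have hn' : (0 : ℝ) < n := by exact_mod_cast Nat.pos_of_ne_zero hn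
  have hx0 : 0 < x := by linarith
  have hlx : 0 < Real.log x := Real.log_pos hx
  have hl2 : Real.log (x ^ 2) = 2 * Real.log x := by rw [Real.log_pow]; norm_num
  rw [smoothedVonMangoldt]
  split_ifs with h1 h2
  · have : Real.log n ≤ Real.log x := Real.log_le_log hn' h1
    rw [max_eq_left (by linarith), max_eq_left (by linarith)]
    ring
  · have e1 : Real.log x ≤ Real.log n := Real.log_le_log hx0 (not_le.1 h1).le
    have e2 : Real.log n ≤ Real.log (x ^ 2) := Real.log_le_log hn' h2
    rw [hl2] at e2
    rw [max_eq_left (by linarith), max_eq_right (by linarith), Real.log_div (by positivity) hn'.ne',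
      hl2]
    field_simp
    ring
  · have e2 : Real.log (x ^ 2) ≤ Real.log n := Real.log_le_log (by positivity) (not_le.1 h2).le
    rw [hl2] at e2
    rw [max_eq_right (by linarith), max_eq_right (by linarith)]
    ring

namespace DirichletCharacter

variable {q : ℕ} {χ : DirichletCharacter ℂ q}

/-- The Dirichlet coefficients `χ(n) Λ(n) n ^ (-s)` of `-L'/L(s + z, χ)`. -/
noncomputable def twistedCoeff (χ : DirichletCharacter ℂ q) (s : ℂ) (n : ℕ) : ℂ :=
  χ n * ArithmeticFunction.vonMangoldt n / (n : ℂ) ^ s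

theorem twistedCoeff_zero (s : ℂ) : twistedCoeff χ s 0 = 0 := by simp [twistedCoeff]

/-- Both ramps vanish for `n ≥ x²`, including `n = x²`, so the strict bound in `smoothedPrimeSum`
loses nothing. -/
theorem tsum_twistedCoeff_eq {x : ℝ} (hx : 1 < x) (s : ℂ) :
    ∑' n : ℕ, twistedCoeff χ s n * (max (2 * Real.log x - Real.log n) 0 : ℝ)
      - ∑' n : ℕ, twistedCoeff χ s n * (max (Real.log x - Real.log n) 0 : ℝ)
      = Real.log x * smoothedPrimeSum χ x s := by
  have hlx : 0 < Real.log x := Real.log_pos hx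
  have hout : ∀ n ∉ Finset.Ico 1 ⌈x ^ 2⌉₊, n ≠ 0 → 2 * Real.log x ≤ Real.log n := by
    intro n hn hn0
    rw [Finset.mem_Ico, not_and, not_lt] at hn
    have h1 : x ^ 2 ≤ n := Nat.ceil_le.1 (hn (Nat.one_le_iff_ne_zero.2 hn0))
    have h2 := Real.log_le_log (by positivity) h1
    rw [Real.log_pow] at h2
    exact_mod_cast h2
  rw [tsum_eq_sum (s := Finset.Ico 1 ⌈x ^ 2⌉₊), tsum_eq_sum (s := Finset.Ico 1 ⌈x ^ 2⌉₊),
    ← Finset.sum_sub_distrib, smoothedPrimeSum, Finset.mul_sum]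
  · refine Finset.sum_congr rfl fun n hn ↦ ?_
    have hn0 : n ≠ 0 := by
      have := (Finset.mem_Ico.1 hn).1
      omega
    have h := congrArg (fun r : ℝ ↦ (r : ℂ)) (log_mul_smoothedVonMangoldt hx hn0)
    simp only [ofReal_mul, ofReal_sub] at h
    rw [twistedCoeff]
    linear_combination -(χ n / (n : ℂ) ^ s) * h
  · intro n hn
    rcases eq_or_ne n 0 with rfl | hn0
    · rw [twistedCoeff_zero, zero_mul]
    · rw [max_eq_right (by linarith [hout n hn hn0]), ofReal_zero, mul_zero]
  · intro n hn
    rcases eq_or_ne n 0 with rfl | hn0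
    · rw [twistedCoeff_zero, zero_mul]
    · rw [max_eq_right (by linarith [hout n hn hn0]), ofReal_zero, mul_zero]

theorem term_twist_vonMangoldt_add (s z : ℂ) (n : ℕ) :
    LSeries.term (fun n : ℕ ↦ χ n * (ArithmeticFunction.vonMangoldt n : ℂ)) (s + z) n
      = twistedCoeff χ s n * cexp (-z * Real.log n) := by
  rcases eq_or_ne n 0 with rfl | hn
  · simp [twistedCoeff]
  have hn' : (n : ℂ) ≠ 0 := Nat.cast_ne_zero.2 hn
  rw [LSeries.term_of_ne_zero hn, twistedCoeff, cpow_add _ _ hn', cpow_def_of_ne_zero hn' z,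
    ← natCast_log, neg_mul, Complex.exp_neg, mul_comm z]
  field_simp

theorem tsum_twistedCoeff_mul_cexp [NeZero q] {s z : ℂ} (hs : 1 < (s + z).re) :
    ∑' n : ℕ, twistedCoeff χ s n * cexp (-z * Real.log n) = -logDeriv (LFunction χ) (s + z) := by
  have h := LSeries_twist_vonMangoldt_eq χ hs
  have hev : LFunction χ =ᶠ[𝓝 (s + z)] LSeries (fun n : ℕ ↦ χ n) := by
    filter_upwards [(isOpen_lt continuous_const continuous_re).mem_nhds hs] with w hw
    exact LFunction_eq_LSeries χ hw
  rw [logDeriv_apply, hev.deriv_eq, hev.self_of_nhds, ← neg_div, ← h, LSeries]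
  exact tsum_congr fun n ↦ (term_twist_vonMangoldt_add s z n).symm

theorem summable_norm_twistedCoeff_div {s : ℂ} (hs : 0 < s.re) :
    Summable fun n : ℕ ↦ ‖twistedCoeff χ s n‖ / n := by
  have h := LSeriesSummable_twist_vonMangoldt χ (s := s + 1) (by simpa using hs)
  refine (Summable.norm h).congr fun n ↦ ?_
  rcases eq_or_ne n 0 with rfl | hn
  · simp
  have hn' : (0 : ℝ) < n := by exact_mod_cast Nat.pos_of_ne_zero hn
  have h1 : ‖cexp (-1 * (Real.log n : ℂ))‖ = (n : ℝ)⁻¹ := by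
    rw [Complex.norm_exp, neg_one_mul, neg_re, ofReal_re, Real.exp_neg, Real.exp_log hn']
  have := term_twist_vonMangoldt_add (χ := χ) s 1 n
  rw [div_eq_mul_inv, ← h1, ← norm_mul, ← this]
  rfl

theorem tsum_sum_type_cexp {ι : Type} {m : ι → ℝ} {a : ι → ℂ} {b : ℕ → ℂ}
    (hm : Summable fun i ↦ |m i| / ‖a i‖ ^ 2) (ha : ∀ i, 0 < (a i).re)
    (hb : Summable fun n ↦ 1 / ‖b n‖ ^ 2) (hbre : ∀ n, 0 < (b n).re) {u : ℝ} (hu : 0 ≤ u) :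
    Summable (fun i ↦ (m i : ℂ) * ((1 - cexp (-a i * u)) / a i ^ 2)) ∧
      Summable (fun n ↦ (1 - cexp (-b n * u)) / b n ^ 2) := by
  have key : ∀ z : ℂ, 0 < z.re → ‖1 - cexp (-z * u)‖ ≤ 2 := fun z hz ↦ by
    refine (norm_sub_le _ _).trans ?_
    have : ‖cexp (-z * u)‖ ≤ 1 := by
      rw [Complex.norm_exp, Real.exp_le_one_iff]
      simp
      positivity
    rw [norm_one]
    linarith
  constructor
  · refine Summable.of_norm_bounded (hm.mul_left 2) fun i ↦ ?_
    rw [norm_mul, norm_div, norm_pow, Complex.norm_real, Real.norm_eq_abs]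
    have := key (a i) (ha i)
    calc |m i| * (‖1 - cexp (-a i * u)‖ / ‖a i‖ ^ 2) ≤ |m i| * (2 / ‖a i‖ ^ 2) := by gcongr
      _ = _ := by ring
  · refine Summable.of_norm_bounded (hb.mul_left 2) fun n ↦ ?_
    rw [norm_div, norm_pow, mul_one_div]
    gcongr
    exact key (b n) (hbre n)

/-- Selberg's explicit formula for `L'/L(s, χ)`, with the zeros `1/2 + iγ` of `Λ(s, χ)` and the
trivial zeros `-κ - 2n`. -/
theorem explicit_formula [NeZero q] {ι : Type} [Countable ι] {m γ : ι → ℝ} {κ : ℕ}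
    (hm0 : ∀ i, 0 ≤ m i)
    (hχ1 : χ ≠ 1) (hGRH : GRHFor χ) (hκ : ∀ s, gammaFactor χ s = Gammaℝ (s + κ))
    (hpf : ∀ s s' : ℂ, 1 / 2 < s.re → 1 / 2 < s'.re →
        HasSum (fun i ↦ (m i : ℂ) * (1 / (s - (1 / 2 + γ i * I)) - 1 / (s' - (1 / 2 + γ i * I))))
          (logDeriv (completedLFunction χ) s - logDeriv (completedLFunction χ) s'))
    {s : ℂ} (hs : 1 / 2 < s.re)
    (hsum : Summable fun i ↦ m i / ‖s - (1 / 2 + γ i * I)‖ ^ 2) {x : ℝ} (hx : 1 < x) :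
    logDeriv (LFunction χ) s = -smoothedPrimeSum χ x s
      + (∑' i, (m i : ℂ) * ((cexp (-(s - (1 / 2 + γ i * I)) * Real.log x)
          - cexp (-(s - (1 / 2 + γ i * I)) * (2 * Real.log x : ℝ)))
            / (s - (1 / 2 + γ i * I)) ^ 2)) / Real.log x
      + (∑' n : ℕ, (cexp (-(s + κ + 2 * n) * Real.log x)
          - cexp (-(s + κ + 2 * n) * (2 * Real.log x : ℝ))) / (s + κ + 2 * n) ^ 2)
        / Real.log x := by
  have hlx : 0 < Real.log x := Real.log_pos hx
  have hκ0 : (0 : ℝ) ≤ κ := Nat.cast_nonneg κ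
  set a : ι → ℂ := fun i ↦ s - (1 / 2 + γ i * I) with ha
  set b : ℕ → ℂ := fun n ↦ s + κ + 2 * n with hb
  have hare : ∀ i, 0 < (a i).re := fun i ↦ by simp [ha]; linarith
  have hbre : ∀ n, 0 < (b n).re := fun n ↦ by
    have : (b n).re = s.re + κ + 2 * n := by simp [hb]
    rw [this]; positivity
  have hasum : Summable fun i ↦ |m i| / ‖a i‖ ^ 2 := by
    simpa only [abs_of_nonneg (hm0 _)] using hsum
  have hbsum : Summable fun n ↦ 1 / ‖b n‖ ^ 2 := by
    refine Summable.of_nonneg_of_le (fun n ↦ by positivity) (fun n ↦ ?_)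
      (summable_one_div_add_natCast_sq (show (0 : ℝ) < 1 / 2 by norm_num))
    have h1 : 1 / 2 + (n : ℝ) ≤ ‖b n‖ := by
      refine le_trans ?_ (re_le_norm (b n))
      have : (b n).re = s.re + κ + 2 * n := by simp [hb]
      rw [this]
      linarith [(Nat.cast_nonneg n : (0 : ℝ) ≤ n)]
    gcongr
  -- Zeros of `Λ` and trivial zeros, the latter coming from the digamma term, form one family
  -- indexed by `ι ⊕ ℕ`. The constants in `Λ'/Λ = L'/L - (log π)/2 + ψ/2` cancel between `s` and `s
  -- + z`.
  have hexp : ∀ z : ℂ, z.re = 2 → ∑' n : ℕ, twistedCoeff χ s n * cexp (-z * Real.log n)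
      = -logDeriv (LFunction χ) s + ∑' i : ι ⊕ ℕ, ((Sum.elim m (fun _ ↦ 1) i : ℝ) : ℂ)
          * (1 / Sum.elim a b i - 1 / (z + Sum.elim a b i)) := by
    intro z hz
    have hsz : 1 / 2 < (s + z).re := by rw [add_re]; linarith
    rw [tsum_twistedCoeff_mul_cexp (by rw [add_re]; linarith)]
    have h1 := hpf s (s + z) hs hsz
    have h2 : HasSum (fun n : ℕ ↦ 1 / b n - 1 / (z + b n))
        (digamma ((s + z + κ) / 2) / 2 - digamma ((s + κ) / 2) / 2) := by
      have hw : 0 < ((s + κ) / 2).re := by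
        have : ((s + κ) / 2).re = (s.re + κ) / 2 := by simp
        rw [this]; positivity
      have hz' : 0 < ((s + z + κ) / 2).re := by
        have : ((s + z + κ) / 2).re = (s.re + z.re + κ) / 2 := by simp
        rw [this, hz]; positivity
      have := (Complex.hasSum_digamma_sub_digamma hz' hw).div_const 2
      rw [sub_div] at this
      refine Eq.mp (congrArg (fun f ↦ HasSum f _) (funext fun n ↦ ?_)) this
      have hb0 : b n ≠ 0 := fun h ↦ by simpa [h] using hbre n
      have hzb0 : z + b n ≠ 0 := fun h ↦ by
        have := congrArg re h
        rw [add_re, hz, zero_re] at this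
        linarith [hbre n]
      have e1 : (s + κ) / 2 + n = b n / 2 := by simp only [hb]; ring
      have e2 : (s + z + κ) / 2 + n = (z + b n) / 2 := by simp only [hb]; ring
      rw [e1, e2]
      field_simp
    have h3 : HasSum (fun i : ι ⊕ ℕ ↦ ((Sum.elim m (fun _ ↦ 1) i : ℝ) : ℂ)
          * (1 / Sum.elim a b i - 1 / (z + Sum.elim a b i)))
        ((logDeriv (completedLFunction χ) s - logDeriv (completedLFunction χ) (s + z))
          + (digamma ((s + z + κ) / 2) / 2 - digamma ((s + κ) / 2) / 2)) := by
      refine HasSum.sum ?_ ?_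
      · refine Eq.mp (congrArg (fun f ↦ HasSum f _) (funext fun i ↦ ?_)) h1
        simp only [Function.comp_apply, Sum.elim_inl, ha]
        ring_nf
      · refine Eq.mp (congrArg (fun f ↦ HasSum f _) (funext fun i ↦ ?_)) h2
        simp
    rw [h3.tsum_eq, logDeriv_completedLFunction_eq hχ1 hGRH hκ hs,
      logDeriv_completedLFunction_eq hχ1 hGRH hκ hsz]
    ring
  have hform : ∀ u : ℝ, 0 ≤ u → ∑' n : ℕ, twistedCoeff χ s n * (max (u - Real.log n) 0 : ℝ)
      = -logDeriv (LFunction χ) s * u + (∑' i, (m i : ℂ) * ((1 - cexp (-a i * u)) / a i ^ 2)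
        + ∑' n, (1 - cexp (-b n * u)) / b n ^ 2) := by
    intro u hu
    have hs1 : Summable fun i : ι ⊕ ℕ ↦
        |Sum.elim m (fun _ ↦ 1) i| / ‖Sum.elim a b i‖ ^ 2 := by
      refine (HasSum.sum (f := fun i : ι ⊕ ℕ ↦
        |Sum.elim m (fun _ ↦ 1) i| / ‖Sum.elim a b i‖ ^ 2)
        (b := ∑' n, 1 / ‖b n‖ ^ 2) hasum.hasSum ?_).summable
      simpa [Function.comp_def] using hbsum.hasSum
    rw [tsum_mul_max_sub_log_eq (w := Sum.elim m (fun _ ↦ 1)) (a := Sum.elim a b)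
      (twistedCoeff_zero s) (summable_norm_twistedCoeff_div (by linarith))
      (by rintro (i | n); exacts [hare i, hbre n]) hs1 hexp hu]
    obtain ⟨hA, hB⟩ := tsum_sum_type_cexp hasum hare hbsum hbre hu
    congr 1
    rw [Summable.tsum_sum (by simpa [Function.comp_def] using hA)
      (by simpa [Function.comp_def] using hB)]
    simp
  -- Subtracting the formulas at `u = 2 log x` and `u = log x` leaves `-L'/L(s) log x` and turns `1
  -- - exp(-au)` into `x^(-a) - x^(-2a)`.
  have h2u := hform (2 * Real.log x) (by positivity)
  have h1u := hform (Real.log x) hlx.le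
  have hS := tsum_twistedCoeff_eq (χ := χ) hx s
  rw [h2u, h1u] at hS
  obtain ⟨hA1, hB1⟩ := tsum_sum_type_cexp hasum hare hbsum hbre hlx.le
  obtain ⟨hA2, hB2⟩ := tsum_sum_type_cexp hasum hare hbsum hbre
    (u := 2 * Real.log x) (by positivity)
  have hA : ∑' i, (m i : ℂ) * ((cexp (-a i * Real.log x) - cexp (-a i * (2 * Real.log x : ℝ)))
      / a i ^ 2) = ∑' i, (m i : ℂ) * ((1 - cexp (-a i * (2 * Real.log x : ℝ))) / a i ^ 2)
        - ∑' i, (m i : ℂ) * ((1 - cexp (-a i * Real.log x)) / a i ^ 2) := by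
    rw [← hA2.tsum_sub hA1]
    exact tsum_congr fun i ↦ by ring
  have hB : ∑' n, (cexp (-b n * Real.log x) - cexp (-b n * (2 * Real.log x : ℝ)))
      / b n ^ 2 = ∑' n, (1 - cexp (-b n * (2 * Real.log x : ℝ))) / b n ^ 2
        - ∑' n, (1 - cexp (-b n * Real.log x)) / b n ^ 2 := by
    rw [← hB2.tsum_sub hB1]
    exact tsum_congr fun i ↦ by ring
  have hlx' : (Real.log x : ℂ) ≠ 0 := ofReal_ne_zero.2 hlx.ne'
  rw [hA, hB]
  generalize ∑' i, (m i : ℂ) * ((1 - cexp (-a i * (2 * Real.log x : ℝ))) / a i ^ 2) = A₂ at hS ⊢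
  generalize ∑' i, (m i : ℂ) * ((1 - cexp (-a i * Real.log x)) / a i ^ 2) = A₁ at hS ⊢
  generalize ∑' n, (1 - cexp (-b n * (2 * Real.log x : ℝ))) / b n ^ 2 = B₂ at hS ⊢
  generalize ∑' n, (1 - cexp (-b n * Real.log x)) / b n ^ 2 = B₁ at hS ⊢
  push_cast at hS
  field_simp
  linear_combination -hS

end DirichletCharacter

end

/-! ### Estimates and elimination of the sum over zeros -/

section

open Complex Metric Filter Topology MeasureTheory

theorem norm_cexp_sub_cexp_two_mul_log_le {x : ℝ} (hx : 0 < x) (a : ℂ) :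
    ‖cexp (-a * Real.log x) - cexp (-a * (2 * Real.log x : ℝ))‖
      ≤ x ^ (-a.re) * (1 + x ^ (-a.re)) := by
  have h1 : ‖cexp (-a * Real.log x)‖ = x ^ (-a.re) := by
    rw [norm_exp, re_mul_ofReal, neg_re, Real.rpow_def_of_pos hx, mul_comm]
  have h2 : ‖cexp (-a * (2 * Real.log x : ℝ))‖ = x ^ (-a.re) * x ^ (-a.re) := by
    rw [norm_exp, re_mul_ofReal, neg_re, Real.rpow_def_of_pos hx, ← Real.exp_add]
    ring_nf
  calc _ ≤ _ := norm_sub_le _ _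
    _ = _ := by rw [h1, h2]; ring

theorem one_le_log_of_four_le {x : ℝ} (hx : 4 ≤ x) : 1 ≤ Real.log x := by
  rw [Real.le_log_iff_exp_le (by linarith)]
  linarith [Real.exp_one_lt_d9]

theorem half_lt_sigmaOne {x : ℝ} (hx : 4 ≤ x) : 1 / 2 < sigmaOne x := by
  have := one_le_log_of_four_le hx
  unfold sigmaOne
  linarith [show 0 < 1 / Real.log x by positivity]

theorem rpow_half_sub_sigmaOne {x : ℝ} (hx : 4 ≤ x) :
    x ^ (1 / 2 - sigmaOne x) = 1 / Real.exp 1 := by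
  have := one_le_log_of_four_le hx
  rw [Real.rpow_def_of_pos (by linarith), sigmaOne, one_div (Real.exp 1), ← Real.exp_neg]
  congr 1
  field_simp
  ring

/-- The contribution of the nontrivial zeros to the explicit formula at `σ + it`, for `σ ≥ σ₁`,
is controlled by their contribution to the partial fraction expansion at `σ₁ + it`. -/
theorem norm_tsum_zeros_le {ι : Type} {m γ : ι → ℝ} (hm : ∀ i, 0 ≤ m i) {x t σ A : ℝ}
    (hx : 4 ≤ x) (hσ : sigmaOne x ≤ σ)
    (hA : HasSum (fun i ↦ m i * (1 / ((sigmaOne x + t * I) - (1 / 2 + γ i * I))).re) A) :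
    ‖(∑' i, (m i : ℂ) * ((cexp (-((σ + t * I) - (1 / 2 + γ i * I)) * Real.log x)
        - cexp (-((σ + t * I) - (1 / 2 + γ i * I)) * (2 * Real.log x : ℝ)))
          / ((σ + t * I) - (1 / 2 + γ i * I)) ^ 2) : ℂ) / Real.log x‖
      ≤ x ^ (1 / 2 - σ) * (1 + x ^ (1 / 2 - σ)) * A := by
  have hlog := one_le_log_of_four_le hx
  have h12 := half_lt_sigmaOne hx
  have hX : 0 < x ^ (1 / 2 - σ) := by positivity
  rw [norm_div, norm_real, Real.norm_of_nonneg (by linarith), div_le_iff₀ (by linarith),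
    mul_assoc]
  have hA' := (hA.mul_left (x ^ (1 / 2 - σ) * (1 + x ^ (1 / 2 - σ)))).mul_right (Real.log x)
  rw [mul_assoc] at hA'
  refine tsum_of_norm_bounded hA' fun i ↦ ?_
  rw [one_div_re_eq, norm_mul, norm_div, norm_real, Real.norm_of_nonneg (hm i), norm_pow]
  have hre (τ : ℝ) : ((τ : ℂ) + t * I - (1 / 2 + γ i * I)).re = τ - 1 / 2 := by simp
  have him (τ : ℝ) : ((τ : ℂ) + t * I - (1 / 2 + γ i * I)).im = t - γ i := by simp
  have hsq (τ : ℝ) : ‖(τ : ℂ) + t * I - (1 / 2 + γ i * I)‖ ^ 2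
      = (τ - 1 / 2) ^ 2 + (t - γ i) ^ 2 := by
    rw [← normSq_eq_norm_sq, normSq_apply, hre, him]; ring
  have hpos : 0 < (sigmaOne x - 1 / 2) ^ 2 + (t - γ i) ^ 2 := by
    have : 0 < sigmaOne x - 1 / 2 := by linarith
    positivity
  have hle : (sigmaOne x - 1 / 2) ^ 2 + (t - γ i) ^ 2 ≤ (σ - 1 / 2) ^ 2 + (t - γ i) ^ 2 := by
    gcongr
  have hnum := norm_cexp_sub_cexp_two_mul_log_le (by linarith : 0 < x)
    ((σ : ℂ) + t * I - (1 / 2 + γ i * I))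
  rw [hre, neg_sub σ] at hnum
  -- This is what the choice of `σ₁` is for: `log x` cancels the numerator of `Re 1/(σ₁+it-ρ)`,
  -- leaving `1/|σ₁+it-ρ|²`, which dominates `1/|σ+it-ρ|²`.
  have hs1 : (((sigmaOne x : ℂ) + t * I).re - 1 / 2) * Real.log x = 1 := by
    simp [sigmaOne]
    field_simp
  rw [hsq, hsq]
  calc _ ≤ m i * ((x ^ (1 / 2 - σ) * (1 + x ^ (1 / 2 - σ)))
        / ((sigmaOne x - 1 / 2) ^ 2 + (t - γ i) ^ 2)) := by
        have := hm i
        gcongr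
    _ = _ := by
        rw [mul_assoc (x ^ (1 / 2 - σ) * _), mul_assoc (m i), div_mul_eq_mul_div, hs1]
        ring

theorem norm_tsum_trivialZeros_le (κ : ℕ) {x t σ : ℝ} (hx : 4 ≤ x) (hσ : 1 / 2 ≤ σ) :
    ‖(∑' n : ℕ, (cexp (-((σ + t * I) + κ + 2 * n) * Real.log x)
        - cexp (-((σ + t * I) + κ + 2 * n) * (2 * Real.log x : ℝ)))
          / ((σ + t * I) + κ + 2 * n) ^ 2 : ℂ) / Real.log x‖
      ≤ (2 * ∑' n : ℕ, 1 / ((1 / 2 : ℝ) + n) ^ 2) * x ^ (1 / 2 - σ) := by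
  have hlog := one_le_log_of_four_le hx
  have hX : 0 < x ^ (1 / 2 - σ) := by positivity
  rw [norm_div, norm_real, Real.norm_of_nonneg (by linarith)]
  refine (div_le_self (norm_nonneg _) hlog).trans ?_
  have hsum := (((summable_one_div_add_natCast_sq (by norm_num : (0 : ℝ) < 1 / 2)).hasSum.mul_left
    2).mul_right (x ^ (1 / 2 - σ)))
  refine tsum_of_norm_bounded hsum fun n ↦ ?_
  have hre : ((σ : ℂ) + t * I + κ + 2 * n).re = σ + κ + 2 * n := by simp
  have hκ : (0 : ℝ) ≤ κ := κ.cast_nonneg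
  have hn : (0 : ℝ) ≤ n := n.cast_nonneg
  have hnum := norm_cexp_sub_cexp_two_mul_log_le (by linarith : 0 < x)
    ((σ : ℂ) + t * I + κ + 2 * n)
  rw [hre] at hnum
  have hle : x ^ (-(σ + κ + 2 * n)) ≤ x ^ (1 / 2 - σ) :=
    Real.rpow_le_rpow_of_exponent_le (by linarith) (by linarith)
  have hle1 : x ^ (-(σ + κ + 2 * n)) ≤ 1 :=
    Real.rpow_le_one_of_one_le_of_nonpos (by linarith) (by linarith)
  have hden : 1 / 2 + (n : ℝ) ≤ ‖(σ : ℂ) + t * I + κ + 2 * n‖ := by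
    refine le_trans ?_ (re_le_norm _)
    rw [hre]; linarith
  rw [norm_div, norm_pow]
  calc _ ≤ (x ^ (1 / 2 - σ) * (1 + 1)) / (1 / 2 + (n : ℝ)) ^ 2 := by
        gcongr
        refine hnum.trans ?_
        gcongr
    _ = _ := by ring

theorem abs_log_norm_sub_log_add_one_le {κ : ℕ} (hκ : κ ≤ 1) {σ t : ℝ} (hσ : 1 / 2 ≤ σ)
    (hσ' : σ ≤ 3 / 2) (ht : 2 ≤ t) :
    |Real.log ‖((σ : ℂ) + t * I + κ) / 2‖ - Real.log (t + 1)| ≤ Real.log 3 := by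
  have hκ0 : (0 : ℝ) ≤ κ := κ.cast_nonneg
  have hκ1 : (κ : ℝ) ≤ 1 := by exact_mod_cast hκ
  have hsq : ‖((σ : ℂ) + t * I + κ) / 2‖ ^ 2 = ((σ + κ) / 2) ^ 2 + (t / 2) ^ 2 := by
    rw [← normSq_eq_norm_sq, normSq_apply]
    simp
    ring
  have hub : ‖((σ : ℂ) + t * I + κ) / 2‖ ≤ 3 * (t + 1) :=
    le_of_sq_le_sq (by rw [hsq]; nlinarith) (by positivity)
  -- Here `t/2 ≥ (t+1)/3` is exactly `t ≥ 2`.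
  have hlb : (t + 1) / 3 ≤ ‖((σ : ℂ) + t * I + κ) / 2‖ :=
    le_of_sq_le_sq (by rw [hsq]; nlinarith) (norm_nonneg _)
  have h1 := Real.log_le_log (by linarith) hlb
  have h2 := Real.log_le_log (by linarith) hub
  rw [Real.log_div (by linarith) (by norm_num)] at h1
  rw [Real.log_mul (by norm_num) (by linarith)] at h2
  rw [abs_le]
  constructor <;> linarith

theorem inv_exp_one_mul_le : 1 / Real.exp 1 * (1 + 1 / Real.exp 1) ≤ 3 / 5 := by
  have h1 : 1 / Real.exp 1 ≤ 0.37 := by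
    rw [div_le_iff₀ (Real.exp_pos 1)]
    linarith [Real.exp_one_gt_d9]
  have h2 : 0 < 1 / Real.exp 1 := by positivity
  nlinarith

theorem DirichletCharacter.IsPrimitive.ne_one {q : ℕ} {χ : DirichletCharacter ℂ q}
    (hχ : χ.IsPrimitive) (hq : 1 < q) : χ ≠ 1 := by
  rintro rfl
  have : NeZero q := ⟨by omega⟩
  rw [isPrimitive_def, conductor_one] at hχ
  omega

/-- The sum `A = ∑ Re 1 / (σ₁ + it - ρ)` over the nontrivial zeros, in terms of `L'/L`. -/
theorem DirichletCharacter.exists_abs_re_logDeriv_completedLFunction_sub_le :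
    ∃ C : ℝ, 0 < C ∧ ∀ (q : ℕ) [NeZero q] (χ : DirichletCharacter ℂ q), χ ≠ 1 → GRHFor χ →
      ∀ t x : ℝ, 2 ≤ t → 4 ≤ x →
        |(logDeriv (completedLFunction χ) (sigmaOne x + t * I)).re + Real.log q / 2
          - ((logDeriv (LFunction χ) (sigmaOne x + t * I)).re
            + 1 / 2 * Real.log (q * (t + 1)))| ≤ C := by
  obtain ⟨C, hC, hψ⟩ := exists_abs_re_digamma_sub_log_norm_le
  refine ⟨Real.log Real.pi / 2 + (C + Real.log 3) / 2, ?_, ?_⟩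
  · have h1 : 0 < Real.log Real.pi := Real.log_pos (by linarith [Real.pi_gt_three])
    have h2 : 0 < Real.log 3 := Real.log_pos (by norm_num)
    positivity
  intro q _ χ hχ1 hGRH t x ht hx
  obtain ⟨κ, hκ1, hκ⟩ := exists_gammaFactor_eq χ
  have hlog := one_le_log_of_four_le hx
  have h12 := half_lt_sigmaOne hx
  have h32 : sigmaOne x ≤ 3 / 2 := by
    unfold sigmaOne
    linarith [(div_le_one (by linarith)).2 hlog]
  have hκ0 : (0 : ℝ) ≤ κ := κ.cast_nonneg
  rw [logDeriv_completedLFunction_eq hχ1 hGRH hκ (by simpa using h12)]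
  have hw := hψ (((sigmaOne x : ℂ) + t * I + κ) / 2)
    (by simp; linarith) (by simp; linarith)
  have hn := abs_log_norm_sub_log_add_one_le hκ1 h12.le h32 ht
  have hπ : 0 < Real.log Real.pi := Real.log_pos (by linarith [Real.pi_gt_three])
  rw [Real.log_mul (by exact_mod_cast NeZero.ne q) (by linarith)]
  have hre : (digamma (((sigmaOne x : ℂ) + t * I + κ) / 2) / 2).re
      = (digamma (((sigmaOne x : ℂ) + t * I + κ) / 2)).re / 2 := by
    simp
  simp only [add_re, neg_re, ofReal_re, hre]
  rw [abs_le] at hw hn ⊢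
  constructor <;> linarith

/-- Solving the explicit formula at `σ₁ + it` for `A` and substituting the result into the
explicit formula at `σ + it`. -/
theorem eq_of_explicit_formula {X k A ω' ℓ r C₀ C₁ : ℝ} {D S T ω D₁ S₁ T₁ : ℂ}
    (hX0 : 0 ≤ X) (hX1 : X ≤ 1) (hk : k * ω' ≤ 3 / 5) (hω : ‖ω‖ ≤ 1)
    (hT : ‖T‖ ≤ C₀ * X) (hT₁ : ‖T₁‖ ≤ C₀) (hr : |r| ≤ C₁)
    (hD : D = -S + (X * (1 + X) * A : ℝ) * ω + T)
    (hD₁ : D₁.re = -S₁.re + k * A * ω' + T₁.re)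
    (hA : A = D₁.re + ℓ + r) :
    ∃ R : ℂ, ‖R‖ ≤ (C₀ + 5 * (C₁ + C₀)) * X ∧
      D = -S - ((X * (1 + X) : ℝ) : ℂ) * ω / ((1 - k * ω' : ℝ) : ℂ) * (S₁.re : ℂ)
        + ((X * (1 + X) : ℝ) : ℂ) * ω / ((1 - k * ω' : ℝ) : ℂ) * (ℓ : ℂ) + R := by
  have hd : 2 / 5 ≤ 1 - k * ω' := by linarith
  -- `A` occurs in both relations `hD₁` and `hA`; eliminating `Re D₁` leaves a linear equation whose
  -- coefficient is at least `2/5`.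
  have hA' : A * (1 - k * ω') = -S₁.re + ℓ + (r + T₁.re) := by
    rw [hD₁] at hA; linarith
  refine ⟨T + ((X * (1 + X) : ℝ) : ℂ) * ω / ((1 - k * ω' : ℝ) : ℂ) * ((r + T₁.re : ℝ) : ℂ),
    ?_, ?_⟩
  -- The `5` is `2 / (2/5)`, from `1 + X ≤ 2` and the lower bound for the denominator.
  · have h1 : ‖((X * (1 + X) : ℝ) : ℂ) * ω / ((1 - k * ω' : ℝ) : ℂ)‖ ≤ 5 * X := by
      rw [norm_div, norm_mul, norm_real, norm_real, Real.norm_of_nonneg (by positivity),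
        Real.norm_of_nonneg (by linarith), div_le_iff₀ (by linarith)]
      calc _ ≤ X * (1 + 1) * 1 := by gcongr
        _ = 5 * X * (2 / 5) := by ring
        _ ≤ _ := by gcongr
    have h2 : ‖((r + T₁.re : ℝ) : ℂ)‖ ≤ C₁ + C₀ := by
      rw [norm_real, Real.norm_eq_abs]
      exact (abs_add_le _ _).trans (add_le_add hr ((abs_re_le_norm _).trans hT₁))
    calc _ ≤ C₀ * X + 5 * X * (C₁ + C₀) := by
          refine (norm_add_le _ _).trans (add_le_add hT ?_)
          rw [norm_mul]
          exact mul_le_mul h1 h2 (norm_nonneg _) (by positivity)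
      _ = _ := by ring
  · have hne : ((1 - k * ω' : ℝ) : ℂ) ≠ 0 := ofReal_ne_zero.2 (by linarith)
    have hA'' : (A : ℂ) = ((-S₁.re + ℓ + (r + T₁.re) : ℝ) : ℂ) / ((1 - k * ω' : ℝ) : ℂ) := by
      rw [eq_div_iff hne, ← hA']
      push_cast
      ring
    rw [hD, ofReal_mul, hA'']
    push_cast
    ring

theorem exists_norm_le_one_mul_eq {c : ℝ} {z : ℂ} (h : ‖z‖ ≤ c) :
    ∃ ω : ℂ, ‖ω‖ ≤ 1 ∧ (c : ℂ) * ω = z := by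
  have hc := (norm_nonneg z).trans h
  rcases hc.eq_or_lt with rfl | hc
  · exact ⟨0, by simp, by simpa using (norm_le_zero_iff.1 h).symm⟩
  · refine ⟨z / c, ?_, mul_div_cancel₀ _ (ofReal_ne_zero.2 hc.ne')⟩
    rw [norm_div, norm_real, Real.norm_of_nonneg hc.le]
    exact div_le_one_of_le₀ h hc.le

end

theorem lemma1 :
    ∃ C : ℝ, 0 < C ∧
      ∀ (q : ℕ) [NeZero q] (χ : DirichletCharacter ℂ q), 1 < q → χ.IsPrimitive → GRHFor χ →
        ∀ t x : ℝ, 2 ≤ t → 4 ≤ x → x ≤ t ^ 2 →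
          ∃ ω' : ℝ, -1 ≤ ω' ∧ ω' ≤ 1 ∧
            ∀ σ : ℝ, sigmaOne x ≤ σ →
              ∃ ω R : ℂ, ‖ω‖ ≤ 1 ∧ ‖R‖ ≤ C * x ^ (1 / 2 - σ) ∧
                deriv (DirichletCharacter.LFunction χ) (σ + t * Complex.I) /
                    DirichletCharacter.LFunction χ (σ + t * Complex.I) =
                  -smoothedPrimeSum χ x (σ + t * Complex.I)
                    - correctionFactor x σ ω ω' *
                        ((smoothedPrimeSum χ x (sigmaOne x + t * Complex.I)).re : ℂ)
                    + correctionFactor x σ ω ω' * ((1 / 2 * Real.log (q * (t + 1)) : ℝ) : ℂ)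
                    + R := by
  obtain ⟨C₁, hC₁, hcompl⟩ :=
    DirichletCharacter.exists_abs_re_logDeriv_completedLFunction_sub_le
  set C₀ : ℝ := 2 * ∑' n : ℕ, 1 / ((1 / 2 : ℝ) + n) ^ 2 with hC₀
  have hC₀0 : 0 ≤ C₀ := mul_nonneg zero_le_two (tsum_nonneg fun n ↦ by positivity)
  refine ⟨C₀ + 5 * (C₁ + C₀), by positivity, ?_⟩
  intro q _ χ hq hχ hGRH t x ht hx _
  have hχ1 := hχ.ne_one hq
  obtain ⟨κ, -, hκ⟩ := DirichletCharacter.exists_gammaFactor_eq χ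
  obtain ⟨ι, _, m, γ, hm, hre, hpf⟩ := hχ.exists_partialFraction hχ1 hGRH
  have h12 := half_lt_sigmaOne hx
  have hA := hre (sigmaOne x + t * Complex.I) (by simpa using h12)
  have hr := hcompl q χ hχ1 hGRH t x ht hx
  set A : ℝ := (logDeriv (DirichletCharacter.completedLFunction χ)
    (sigmaOne x + t * Complex.I)).re + Real.log q / 2
  have key (σ : ℝ) (hσ : sigmaOne x ≤ σ) : ∃ ω T : ℂ, ‖ω‖ ≤ 1 ∧ ‖T‖ ≤ C₀ * x ^ (1 / 2 - σ) ∧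
      logDeriv (DirichletCharacter.LFunction χ) (σ + t * Complex.I) =
        -smoothedPrimeSum χ x (σ + t * Complex.I)
          + (x ^ (1 / 2 - σ) * (1 + x ^ (1 / 2 - σ)) * A : ℝ) * ω + T := by
    have hs : 1 / 2 < ((σ : ℂ) + t * Complex.I).re := by simpa using h12.trans_le hσ
    have hsum : Summable fun i ↦
        m i / ‖(σ : ℂ) + t * Complex.I - (1 / 2 + γ i * Complex.I)‖ ^ 2 := by
      have hne : ((σ : ℂ) + t * Complex.I).re - 1 / 2 ≠ 0 := by linarith
      refine ((hre _ hs).summable.div_const (((σ : ℂ) + t * Complex.I).re - 1 / 2)).congr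
        fun i ↦ ?_
      rw [one_div_re_eq, ← mul_div_assoc, div_right_comm, mul_div_cancel_right₀ _ hne]
    obtain ⟨ω, hω, hE⟩ := exists_norm_le_one_mul_eq (norm_tsum_zeros_le hm hx hσ hA)
    refine ⟨ω, _, hω, norm_tsum_trivialZeros_le κ hx (h12.le.trans hσ) (t := t), ?_⟩
    rw [hE]
    exact DirichletCharacter.explicit_formula hm hχ1 hGRH hκ hpf hs hsum (by linarith)
  -- The real part of this `ω₁` serves as `ω'`: it comes from the formula at `σ₁` alone, hence does
  -- not depend on `σ`.
  obtain ⟨ω₁, T₁, hω₁, hT₁, hD₁⟩ := key (sigmaOne x) le_rfl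
  have hω' := abs_le.1 ((Complex.abs_re_le_norm ω₁).trans hω₁)
  refine ⟨ω₁.re, hω'.1, hω'.2, fun σ hσ ↦ ?_⟩
  obtain ⟨ω, T, hω, hT, hD⟩ := key σ hσ
  have he : 1 / Real.exp 1 ≤ 1 := by
    rw [div_le_one (Real.exp_pos 1)]
    linarith [Real.add_one_le_exp 1]
  rw [rpow_half_sub_sigmaOne hx] at hT₁ hD₁
  have hk0 : 0 ≤ 1 / Real.exp 1 * (1 + 1 / Real.exp 1) := by positivity
  obtain ⟨R, hR, hDR⟩ := eq_of_explicit_formula (X := x ^ (1 / 2 - σ))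
    (k := 1 / Real.exp 1 * (1 + 1 / Real.exp 1)) (ω' := ω₁.re)
    (ℓ := 1 / 2 * Real.log (q * (t + 1)))
    (D₁ := logDeriv (DirichletCharacter.LFunction χ) (sigmaOne x + t * Complex.I))
    (S₁ := smoothedPrimeSum χ x (sigmaOne x + t * Complex.I)) (by positivity)
    (Real.rpow_le_one_of_one_le_of_nonpos (by linarith) (by linarith))
    (by nlinarith [inv_exp_one_mul_le]) hω hT
    (hT₁.trans (mul_le_of_le_one_right hC₀0 he)) hr hD
    (by rw [hD₁]; simp only [Complex.add_re, Complex.neg_re, Complex.re_ofReal_mul])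
    (by ring)
  exact ⟨ω, R, hω, hR, hDR⟩
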